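/- Let $\mathcal B$ be a complex Banach space and let $H$ be a closed densely defined linear operator on $\mathcal B$ with spectrum $\sigma(H)\subseteq[0,\infty)$ such that, for some constants $c$ and $\alpha\ge 0$, $$\|(z-H)^{-1}\|\le c\,|\operatorname{Im} z|^{-1}\Big(\frac{\langle z\rangle}{|\operatorname{Im} z|}\Big)^{\alpha}\qquad (z\in\mathbb C\setminus\mathbb R),\qquad \langle z\rangle:=(1+|z|^2)^{1/2}.$$ Let $\mathcal A$ be the set of smooth $f:\mathbb R\to\mathbb C$ for which there is $\beta<0$ such that for every $k\ge0$ there is $c_k>0$ with $|f^{(k)}(x)|\le c_k\langle x\rangle^{\beta-k}$ for all $x\in\mathbb R$, and let $\mathcal A^+$ be the set of smooth functions on $[0,\infty)$ defined by the same estimates on $[0,\infty)$. Fix an integer $N>\alpha$ and a smooth function $\tau:\mathbb C\to\mathbb R$ with $\tau(x,y)=1$ if $|y|\le\langle x\rangle$, $\tau(x,y)=0$ if $|y|\ge2\langle x\rangle$, and first derivatives bounded by a constant times $\langle x\rangle^{-1}$. For $g\in\mathcal A$ put $$\tilde g(x,y):=\Big(\sum_{r=0}^N g^{(r)}(x)\frac{(iy)^r}{r!}\Big)\tau(x,y),\qquad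 \frac{\partial\tilde g}{\partial\bar z}:=\frac12\Big(\frac{\partial\tilde g}{\partial x}+i\frac{\partial\tilde g}{\partial y}\Big),\qquad g(H):=-\frac1\pi\iint_{\mathbb C}\frac{\partial\tilde g}{\partial\bar z}\,(z-H)^{-1}\,dx\,dy,$$ and for $f\in\mathcal A^+$ put $\gamma_H(f):=g(H)$, where $g\in\mathcal A$ is an extension of $f$, that is, $g|_{[0,\infty)}=f$. Let $n\ge1$ be an integer. Then for every $t>0$ the function $s\mapsto e^{-s^nt}$ on $[0,\infty)$ belongs to $\mathcal A^+$ and has an extension in $\mathcal A$; for every such extension $g$ the integral defining $g(H)$ is norm convergent, and the operator $g(H)$ does not depend on the choice of $g$. Hence $e^{-H^nt}:=\gamma_H(e^{-s^nt})$ is a well defined bounded operator on $\mathcal B$. Moreover, for all $t_1,t_2>0$, $$e^{-H^n(t_1+t_2)}=e^{-H^nt_1}\,e^{-H^nt_2}.$$ -/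

import Mathlib

open MeasureTheory Set
open scoped ContDiff

namespace HelfferSjostrand

noncomputable section

/-- The bracket `⟨x⟩ = (1 + |x|²)^{1/2}`, used for real and for complex `x`. -/
def bracket {E : Type*} [Norm E] (x : E) : ℝ := Real.sqrt (1 + ‖x‖ ^ 2)

/-- `S^β`: smooth `f : ℝ → ℂ` with `|f⁽ᵏ⁾(x)| ≤ c_k ⟨x⟩^{β - k}` for every `k`. -/
def symbolClass (β : ℝ) : Set (ℝ → ℂ) :=
  {f | ContDiff ℝ ∞ f ∧
    ∀ k : ℕ, ∃ c : ℝ, 0 < c ∧ ∀ x : ℝ, ‖iteratedDeriv k f x‖ ≤ c * bracket x ^ (β - (k : ℝ))}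

/-- The algebra `𝒜 = ⋃_{β < 0} S^β`. -/
def algA : Set (ℝ → ℂ) := {f | ∃ β : ℝ, β < 0 ∧ f ∈ symbolClass β}

/-- `S^β_+`: the same decay for smooth functions on `[0, ∞)` (with one-sided derivatives at `0`).
Such a function is represented by any function on `ℝ` that agrees with it on `[0, ∞)`. -/
def symbolClassPlus (β : ℝ) : Set (ℝ → ℂ) :=
  {f | ContDiffOn ℝ ∞ f (Ici 0) ∧
    ∀ k : ℕ, ∃ c : ℝ, 0 < c ∧ ∀ x : ℝ, 0 ≤ x →
      ‖iteratedDerivWithin k f (Ici 0) x‖ ≤ c * bracket x ^ (β - (k : ℝ))}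

/-- The algebra `𝒜⁺ = ⋃_{β < 0} S^β_+`. -/
def algAPlus : Set (ℝ → ℂ) := {f | ∃ β : ℝ, β < 0 ∧ f ∈ symbolClassPlus β}

/-- `g ∈ 𝒜` is an extension to `ℝ` of the function that `f` defines on `[0, ∞)`. -/
def IsExtension (g f : ℝ → ℂ) : Prop := g ∈ algA ∧ EqOn g f (Ici 0)

/-- Cut-off functions `τ(x, y)`, `z = x + iy`: smooth, equal to `1` for `|y| ≤ ⟨x⟩` and to `0` for
`|y| ≥ 2⟨x⟩`, with first derivatives `O(⟨x⟩⁻¹)`. A standard example is `τ(x, y) = φ(y / ⟨x⟩)` with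
`φ` smooth on `ℝ`, `φ = 1` on `[-1, 1]` and `φ = 0` off `(-2, 2)`. -/
structure IsCutoff (τ : ℂ → ℝ) : Prop where
  smooth : ContDiff ℝ ∞ τ
  eq_one : ∀ z : ℂ, |z.im| ≤ bracket z.re → τ z = 1
  eq_zero : ∀ z : ℂ, 2 * bracket z.re ≤ |z.im| → τ z = 0
  deriv_bound : ∃ C : ℝ, ∀ z : ℂ, ‖fderiv ℝ τ z‖ ≤ C / bracket z.re

/-- The almost analytic extension
`f̃(x, y) = (∑_{r ≤ N} f⁽ʳ⁾(x) (iy)^r / r!) τ(x, y)` of order `N`. -/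
def almostAnalyticExt (N : ℕ) (τ : ℂ → ℝ) (f : ℝ → ℂ) (z : ℂ) : ℂ :=
  (∑ r ∈ Finset.range (N + 1),
    iteratedDeriv r f z.re * (Complex.I * (z.im : ℂ)) ^ r / (r.factorial : ℂ)) * (τ z : ℂ)

/-- `∂F/∂z̄ = (∂F/∂x + i ∂F/∂y) / 2`. -/
def wirtingerBar (F : ℂ → ℂ) (z : ℂ) : ℂ :=
  (fderiv ℝ F z 1 + Complex.I * fderiv ℝ F z Complex.I) / 2

variable {B : Type*} [NormedAddCommGroup B] [NormedSpace ℂ B]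

/-- The bounded operator `R` is a two-sided inverse of `z - H : Dom H → B`. -/
def IsResolventAt (H : B →ₗ.[ℂ] B) (z : ℂ) (R : B →L[ℂ] B) : Prop :=
  (∀ x : B, ∃ hx : R x ∈ H.domain, z • R x - H ⟨R x, hx⟩ = x) ∧
    ∀ v : H.domain, R (z • (v : B) - H v) = v

/-- The spectrum of a (possibly unbounded) operator: the complement of the set of `z` for which
`z - H` has a bounded inverse. -/
def opSpectrum (H : B →ₗ.[ℂ] B) : Set ℂ := {z | ¬ ∃ R : B →L[ℂ] B, IsResolventAt H z R}

open Classical in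
/-- The resolvent `(z - H)⁻¹` off the spectrum (and `0` on the spectrum). -/
def resolventOp (H : B →ₗ.[ℂ] B) (z : ℂ) : B →L[ℂ] B :=
  if h : ∃ R : B →L[ℂ] B, IsResolventAt H z R then h.choose else 0

/-- `H` is closed and densely defined, `σ(H) ⊆ [0, ∞)`, and
`‖(z - H)⁻¹‖ ≤ c |Im z|⁻¹ (⟨z⟩ / |Im z|)^α` for all non-real `z`, where `α ≥ 0`. -/
structure SemiboundedHypothesis (H : B →ₗ.[ℂ] B) (α : ℝ) : Prop where
  closed : H.IsClosed
  dense : Dense (H.domain : Set B)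
  spectrum_subset : opSpectrum H ⊆ (fun x : ℝ => (x : ℂ)) '' Ici 0
  exponent_nonneg : 0 ≤ α
  resolvent_bound : ∃ c : ℝ, ∀ z : ℂ, z.im ≠ 0 →
    ‖resolventOp H z‖ ≤ c * |z.im|⁻¹ * (bracket z / |z.im|) ^ α

/-- The integrand `∂f̃/∂z̄ (z - H)⁻¹`. -/
def hsIntegrand (H : B →ₗ.[ℂ] B) (N : ℕ) (τ : ℂ → ℝ) (f : ℝ → ℂ) (z : ℂ) : B →L[ℂ] B :=
  wirtingerBar (almostAnalyticExt N τ f) z • resolventOp H z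

/-- The Helffer–Sjöstrand formula `f(H) = -(1/π) ∬ ∂f̃/∂z̄ (z - H)⁻¹ dx dy` for `f ∈ 𝒜`. -/
def hsCalculus (H : B →ₗ.[ℂ] B) (N : ℕ) (τ : ℂ → ℝ) (f : ℝ → ℂ) : B →L[ℂ] B :=
  (-(1 / (Real.pi : ℂ))) • ∫ z : ℂ, hsIntegrand H N τ f z

open Classical in
/-- The functional calculus `γ_H` on `𝒜⁺`: `γ_H(f) = g(H)` for an extension `g ∈ 𝒜` of `f`. -/
def gammaCalculus (H : B →ₗ.[ℂ] B) (N : ℕ) (τ : ℂ → ℝ) (f : ℝ → ℂ) : B →L[ℂ] B :=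
  if h : ∃ g : ℝ → ℂ, IsExtension g f then hsCalculus H N τ h.choose else 0

/-- The function `s ↦ e^{-sⁿt}`. -/
def expFun (n : ℕ) (t : ℝ) (s : ℝ) : ℂ := Complex.exp (-((s : ℂ) ^ n * (t : ℂ)))

/-- The operator `e^{-Hⁿt} := γ_H(e^{-sⁿt})`. -/
def expPow (H : B →ₗ.[ℂ] B) (N : ℕ) (τ : ℂ → ℝ) (n : ℕ) (t : ℝ) : B →L[ℂ] B :=
  gammaCalculus H N τ (expFun n t)

end

end HelfferSjostrand

/-!
The Helffer–Sjöstrand integral turns `𝒜` into operators multiplicatively and depends only on the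
values on the spectrum; applied to extensions of `e^{-sⁿt}` this is the semigroup law.

*Convergence.* The sum defining `f̃` is built so that `∂f̃/∂z̄` vanishes to order `N` at the real
axis (`dbar_taylorPart`), which beats the singularity `|Im z|^{-1-α}` of the resolvent because
`N > α`. Together with the symbol estimates this gives an integrable bound for the integrand which
depends on `f` only through its constants (`exists_norm_smul_resolventOp_le`, `integrable_weight`).
Consequently `f(H)` is the limit of `(f χ(· / m))(H)` (`tendsto_hsCalculus_truncate`), and identities
need to be proved for compactly supported functions only.

*Independence of the extension.* If `h` has compact support and vanishes on `[0, ∞)`, then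
`(z - ε - H)⁻¹` is holomorphic near the support of `h̃` for every `ε > 0`, so the integral of
`∂h̃/∂z̄ (z - ε - H)⁻¹` is zero by Stokes' theorem (`integral_dbar_smul_eq_zero`), and dominated
convergence lets `ε → 0` (`hsCalculus_eq_zero_of_hasCompactSupport`).

*Multiplicativity.* In `f(H) g(H)`, written as a double integral, the resolvent identity replaces the
product of the resolvents by `(R(z) - R(w)) / (w - z)`. The Cauchy–Pompeiu formula evaluates one of
the two integrals in each term, and what remains is
`-(1/π) ∬ ∂(f̃ g̃)/∂z̄ R(z)` (`integral_dbar_smul_mul_integral_dbar_smul`). To avoid the singular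
kernel `1 / u` it is approximated by `ū / (|u|² + δ²)`, whose `∂/∂ū` is an approximate identity.
Finally `f̃ g̃` is not the extension of `f g`, but the difference vanishes to order `N + 1` at the
real axis, by the Leibniz rule (`taylorPart_mul`), and such functions do not contribute to the
integral (`integral_dbar_smul_eq_zero_of_vanishing`).
-/

open Filter Topology

namespace HelfferSjostrand

/-! ### The bracket and symbol estimates -/

section Bracket

variable {E : Type*} [NormedAddCommGroup E]

lemma one_le_bracket (x : E) : 1 ≤ bracket x :=
  Real.one_le_sqrt.2 (by nlinarith [sq_nonneg ‖x‖])

lemma bracket_pos (x : E) : 0 < bracket x := zero_lt_one.trans_le (one_le_bracket x)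

lemma bracket_sq (x : E) : bracket x ^ 2 = 1 + ‖x‖ ^ 2 := Real.sq_sqrt (by positivity)

lemma bracket_le_one_add_norm (x : E) : bracket x ≤ 1 + ‖x‖ :=
  Real.sqrt_le_iff.2 ⟨by positivity, by nlinarith [norm_nonneg x]⟩

lemma continuous_bracket : Continuous (bracket : E → ℝ) := by
  unfold bracket; fun_prop

lemma continuous_bracket_rpow (s : ℝ) : Continuous fun x : E => bracket x ^ s :=
  continuous_bracket.rpow_const fun x => Or.inl (bracket_pos x).ne'

/-- Dilation by a factor `c ≤ 1` shrinks the bracket by at most that factor. -/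
lemma mul_bracket_le_bracket_mul {c : ℝ} (h0 : 0 ≤ c) (h1 : c ≤ 1) (x : ℝ) :
    c * bracket x ≤ bracket (c * x) := by
  refine Real.le_sqrt_of_sq_le ?_
  rw [mul_pow, bracket_sq, norm_mul, mul_pow, Real.norm_of_nonneg h0]
  nlinarith

end Bracket

/-- The symbol estimates of order `β` for the derivatives up to order `m`, with one constant `K`. -/
def SymBound (m : ℕ) (β K : ℝ) (f : ℝ → ℂ) : Prop :=
  ∀ k ≤ m, ∀ x : ℝ, ‖iteratedDeriv k f x‖ ≤ K * bracket x ^ (β - (k : ℝ))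

lemma SymBound.nonneg {m : ℕ} {β K : ℝ} {f : ℝ → ℂ} (h : SymBound m β K f) : 0 ≤ K := by
  have h1 := (norm_nonneg _).trans (h 0 (Nat.zero_le _) 0)
  exact nonneg_of_mul_nonneg_left h1 (Real.rpow_pos_of_pos (bracket_pos _) _)

lemma exists_symBound {β : ℝ} {f : ℝ → ℂ} (h : f ∈ symbolClass β) (m : ℕ) :
    ∃ K, SymBound m β K f := by
  choose c hc hb using h.2
  refine ⟨∑ j ∈ Finset.range (m + 1), c j, fun k hk x => (hb k x).trans ?_⟩
  refine mul_le_mul_of_nonneg_right ?_ (Real.rpow_nonneg (bracket_pos _).le _)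
  exact Finset.single_le_sum (f := c) (fun j _ => (hc j).le) (Finset.mem_range.2 (by omega))

lemma SymBound.mul {m : ℕ} {β₁ β₂ K₁ K₂ : ℝ} {f g : ℝ → ℂ} (hf : ContDiff ℝ ∞ f)
    (hg : ContDiff ℝ ∞ g) (h₁ : SymBound m β₁ K₁ f) (h₂ : SymBound m β₂ K₂ g) :
    SymBound m (β₁ + β₂) (2 ^ m * (K₁ * K₂)) (fun x => f x * g x) := by
  intro k hk x
  have hK₁ := h₁.nonneg
  have hK₂ := h₂.nonneg
  rw [iteratedDeriv_fun_mul (hf.contDiffAt.of_le (by exact_mod_cast le_top))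
    (hg.contDiffAt.of_le (by exact_mod_cast le_top))]
  refine (norm_sum_le _ _).trans ?_
  have hterm : ∀ i ∈ Finset.range (k + 1),
      ‖(k.choose i : ℂ) * iteratedDeriv i f x * iteratedDeriv (k - i) g x‖ ≤
        (k.choose i : ℝ) * (K₁ * K₂ * bracket x ^ (β₁ + β₂ - (k : ℝ))) := by
    intro i hi
    have hik : i ≤ k := by simpa [Nat.lt_succ_iff] using hi
    rw [norm_mul, norm_mul, Complex.norm_natCast, mul_assoc]
    refine mul_le_mul_of_nonneg_left ?_ (Nat.cast_nonneg _)
    refine (mul_le_mul (h₁ i (by omega) x) (h₂ (k - i) (by omega) x) (norm_nonneg _)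
      (mul_nonneg hK₁ (Real.rpow_nonneg (bracket_pos _).le _))).trans (le_of_eq ?_)
    have : bracket x ^ (β₁ + β₂ - (k : ℝ)) =
        bracket x ^ (β₁ - (i : ℝ)) * bracket x ^ (β₂ - ((k - i : ℕ) : ℝ)) := by
      rw [← Real.rpow_add (bracket_pos _), Nat.cast_sub hik]; congr 1; ring
    rw [this]; ring
  refine (Finset.sum_le_sum hterm).trans ?_
  rw [← Finset.sum_mul, ← Nat.cast_sum, Nat.sum_range_choose, mul_assoc]
  push_cast
  rw [← mul_assoc (2 ^ m)]
  have : (2 : ℝ) ^ k ≤ 2 ^ m := pow_le_pow_right₀ (by norm_num) hk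
  have h3 : 0 ≤ K₁ * K₂ * bracket x ^ (β₁ + β₂ - (k : ℝ)) := by
    have := Real.rpow_nonneg (bracket_pos x).le (β₁ + β₂ - (k : ℝ)); positivity
  nlinarith

lemma mem_symbolClass_of_symBound {β : ℝ} {f : ℝ → ℂ} (hf : ContDiff ℝ ∞ f)
    (h : ∀ m, ∃ K, SymBound m β K f) : f ∈ symbolClass β := by
  refine ⟨hf, fun k => ?_⟩
  obtain ⟨K, hK⟩ := h k
  refine ⟨K + 1, by linarith [hK.nonneg], fun x => (hK k le_rfl x).trans ?_⟩
  exact mul_le_mul_of_nonneg_right (by linarith) (Real.rpow_nonneg (bracket_pos _).le _)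

lemma algA.contDiff {f : ℝ → ℂ} (hf : f ∈ algA) : ContDiff ℝ ∞ f := by
  obtain ⟨β, -, h⟩ := hf; exact h.1

lemma algA.mul {f g : ℝ → ℂ} (hf : f ∈ algA) (hg : g ∈ algA) : (fun x => f x * g x) ∈ algA := by
  obtain ⟨β₁, hβ₁, h₁⟩ := hf
  obtain ⟨β₂, hβ₂, h₂⟩ := hg
  refine ⟨β₁ + β₂, by linarith, mem_symbolClass_of_symBound (h₁.1.mul h₂.1) fun m => ?_⟩
  obtain ⟨K₁, hK₁⟩ := exists_symBound h₁ m
  obtain ⟨K₂, hK₂⟩ := exists_symBound h₂ m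
  exact ⟨_, hK₁.mul h₁.1 h₂.1 hK₂⟩

lemma algA.sub {f g : ℝ → ℂ} (hf : f ∈ algA) (hg : g ∈ algA) : (fun x => f x - g x) ∈ algA := by
  obtain ⟨β₁, hβ₁, h₁⟩ := hf
  obtain ⟨β₂, hβ₂, h₂⟩ := hg
  refine ⟨max β₁ β₂, max_lt hβ₁ hβ₂, mem_symbolClass_of_symBound (h₁.1.sub h₂.1) fun m => ?_⟩
  obtain ⟨K₁, hK₁⟩ := exists_symBound h₁ m
  obtain ⟨K₂, hK₂⟩ := exists_symBound h₂ m
  refine ⟨K₁ + K₂, fun k hk x => ?_⟩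
  rw [iteratedDeriv_fun_sub (h₁.1.contDiffAt.of_le (by exact_mod_cast le_top))
    (h₂.1.contDiffAt.of_le (by exact_mod_cast le_top)), add_mul]
  refine (norm_sub_le _ _).trans (add_le_add ((hK₁ k hk x).trans ?_) ((hK₂ k hk x).trans ?_))
  · exact mul_le_mul_of_nonneg_left (Real.rpow_le_rpow_of_exponent_le (one_le_bracket _)
      (by linarith [le_max_left β₁ β₂])) hK₁.nonneg
  · exact mul_le_mul_of_nonneg_left (Real.rpow_le_rpow_of_exponent_le (one_le_bracket _)
      (by linarith [le_max_right β₁ β₂])) hK₂.nonneg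

lemma hasCompactSupport_iteratedDeriv {f : ℝ → ℂ} (hf : HasCompactSupport f) (k : ℕ) :
    HasCompactSupport (iteratedDeriv k f) := by
  induction k with
  | zero => simpa using hf
  | succ k ih => rw [iteratedDeriv_succ]; exact ih.deriv

lemma mem_symbolClass_of_hasCompactSupport {f : ℝ → ℂ} (hf : ContDiff ℝ ∞ f)
    (hc : HasCompactSupport f) (β : ℝ) : f ∈ symbolClass β := by
  refine ⟨hf, fun k => ?_⟩
  have hcont : Continuous fun x => ((bracket x ^ (-(β - (k : ℝ))) : ℝ) : ℂ) * iteratedDeriv k f x :=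
    (Complex.continuous_ofReal.comp (continuous_bracket_rpow _)).mul
      (hf.continuous_iteratedDeriv k (by exact_mod_cast le_top))
  obtain ⟨C, hC⟩ := hcont.bounded_above_of_compact_support (hasCompactSupport_iteratedDeriv hc
      k).mul_left
  refine ⟨C + 1, by linarith [(norm_nonneg _).trans (hC 0)], fun x => ?_⟩
  have h := hC x
  have hp : 0 < bracket x ^ (β - (k : ℝ)) := Real.rpow_pos_of_pos (bracket_pos x) _
  rw [norm_mul, Complex.norm_real, Real.rpow_neg (bracket_pos x).le, norm_inv,
    Real.norm_of_nonneg hp.le, inv_mul_le_iff₀ hp] at h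
  nlinarith

lemma mem_algA_of_hasCompactSupport {f : ℝ → ℂ} (hf : ContDiff ℝ ∞ f)
    (hc : HasCompactSupport f) : f ∈ algA :=
  ⟨-1, by norm_num, mem_symbolClass_of_hasCompactSupport hf hc _⟩

/-- Smooth compactly supported functions equal to `1` on `[-1, 1]`. -/
structure IsPlateau (χ : ℝ → ℂ) : Prop where
  smooth : ContDiff ℝ ∞ χ
  compact : HasCompactSupport χ
  eq_one : ∀ x, |x| ≤ 1 → χ x = 1

lemma exists_isPlateau : ∃ χ : ℝ → ℂ, IsPlateau χ := by
  let b : ContDiffBump (0 : ℝ) := ⟨1, 2, by norm_num, by norm_num⟩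
  refine ⟨fun x => (b x : ℂ), Complex.ofRealCLM.contDiff.comp b.contDiff,
    b.hasCompactSupport.comp_left Complex.ofReal_zero, fun x hx => ?_⟩
  have : b x = 1 := b.one_of_mem_closedBall (by simpa using hx)
  simp [this]

lemma IsPlateau.mul {χ₁ χ₂ : ℝ → ℂ} (h₁ : IsPlateau χ₁) (h₂ : IsPlateau χ₂) :
    IsPlateau fun x => χ₁ x * χ₂ x :=
  ⟨h₁.smooth.mul h₂.smooth, h₁.compact.mul_right, fun x hx => by
    rw [h₁.eq_one x hx, h₂.eq_one x hx, one_mul]⟩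

/-- The truncation `f(x) χ(x / (m + 1))`. -/
noncomputable def truncate (χ f : ℝ → ℂ) (m : ℕ) (x : ℝ) : ℂ := f x * χ ((m + 1 : ℝ)⁻¹ * x)

section Truncate

variable {χ f : ℝ → ℂ}

lemma contDiff_truncate (hχ : IsPlateau χ) (hf : ContDiff ℝ ∞ f) (m : ℕ) :
    ContDiff ℝ ∞ (truncate χ f m) :=
  hf.mul (hχ.smooth.comp (contDiff_const.mul contDiff_id))

lemma hasCompactSupport_truncate (hχ : IsPlateau χ) (m : ℕ) :
    HasCompactSupport (truncate χ f m) := by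
  have h : HasCompactSupport fun x : ℝ => χ ((m + 1 : ℝ)⁻¹ • x) :=
    hχ.compact.comp_smul (by positivity)
  exact HasCompactSupport.mul_left (f := f) h

/-- Near a given point the truncations are eventually equal to the function. -/
lemma eventually_truncate_eq (hχ : IsPlateau χ) (x : ℝ) :
    ∀ᶠ m : ℕ in atTop, truncate χ f m =ᶠ[𝓝 x] f := by
  obtain ⟨m₀, hm₀⟩ := exists_nat_ge (|x| + 1)
  filter_upwards [eventually_ge_atTop m₀] with m hm
  filter_upwards [Metric.ball_mem_nhds x one_pos] with y hy
  have hy' : |y - x| < 1 := hy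
  have hmm : (m₀ : ℝ) ≤ m := by exact_mod_cast hm
  have : |y| ≤ m + 1 := by
    have := abs_sub_abs_le_abs_sub y x
    linarith
  rw [truncate, hχ.eq_one, mul_one]
  rw [abs_mul, abs_inv, abs_of_pos (by positivity : (0 : ℝ) < m + 1), inv_mul_le_iff₀ (by
      positivity)]
  linarith

/-- Truncations satisfy the symbol estimates uniformly. -/
lemma exists_symBound_truncate (hχ : IsPlateau χ) {β : ℝ} (hf : f ∈ symbolClass β) (N : ℕ) :
    ∃ K, ∀ m, SymBound N β K (truncate χ f m) := by
  obtain ⟨K₁, hK₁⟩ := exists_symBound hf N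
  obtain ⟨K₂, hK₂⟩ := exists_symBound (mem_symbolClass_of_hasCompactSupport hχ.smooth hχ.compact 0)
      N
  refine ⟨2 ^ N * (K₁ * K₂), fun m => ?_⟩
  have hc0 : (0 : ℝ) < (m + 1 : ℝ)⁻¹ := by positivity
  have hc1 : (m + 1 : ℝ)⁻¹ ≤ 1 := inv_le_one_of_one_le₀ (by linarith [Nat.cast_nonneg (α := ℝ) m])
  have h2 : SymBound N 0 K₂ (fun x => χ ((m + 1 : ℝ)⁻¹ * x)) := by
    intro k hk x
    rw [iteratedDeriv_comp_const_smul (hχ.smooth.of_le (by exact_mod_cast le_top))]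
    rw [norm_smul, norm_pow, Real.norm_of_nonneg hc0.le]
    have hb := hK₂ k hk ((m + 1 : ℝ)⁻¹ * x)
    rw [zero_sub, Real.rpow_neg (bracket_pos _).le, Real.rpow_natCast] at hb ⊢
    calc _ ≤ ((m + 1 : ℝ)⁻¹) ^ k * (K₂ * (bracket ((m + 1 : ℝ)⁻¹ * x) ^ k)⁻¹) := by gcongr
      _ = K₂ * ((bracket ((m + 1 : ℝ)⁻¹ * x) / (m + 1 : ℝ)⁻¹) ^ k)⁻¹ := by
        rw [div_pow, inv_div]; ring
      _ ≤ K₂ * (bracket x ^ k)⁻¹ := by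
        have := bracket_pos x
        have := hK₂.nonneg
        gcongr
        rw [le_div_iff₀ hc0, mul_comm]
        exact mul_bracket_le_bracket_mul hc0.le hc1 x
  simpa using! hK₁.mul hf.1 (hχ.smooth.comp (contDiff_const.mul contDiff_id)) h2

end Truncate

/-! ### The resolvent -/

section Resolvent

variable {B : Type*} [NormedAddCommGroup B] [NormedSpace ℂ B] {H : B →ₗ.[ℂ] B}

lemma isResolventAt_resolventOp {z : ℂ} (hz : z ∉ opSpectrum H) :
    IsResolventAt H z (resolventOp H z) := by
  have h : ∃ R : B →L[ℂ] B, IsResolventAt H z R := not_not.1 hz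
  rw [resolventOp, dif_pos h]
  exact h.choose_spec

/-- The first resolvent identity. -/
lemma resolventOp_sub {z w : ℂ} (hz : z ∉ opSpectrum H) (hw : w ∉ opSpectrum H) :
    resolventOp H z - resolventOp H w = (w - z) • (resolventOp H z * resolventOp H w) := by
  ext x
  obtain ⟨hx, hxe⟩ := (isResolventAt_resolventOp hw).1 x
  have h := (isResolventAt_resolventOp hz).2 ⟨resolventOp H w x, hx⟩
  have h2 : z • resolventOp H w x - H ⟨resolventOp H w x, hx⟩ =
      x - (w - z) • resolventOp H w x := by
    calc _ = (w • resolventOp H w x - H ⟨resolventOp H w x, hx⟩) - (w - z) • resolventOp H w x := by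
          rw [sub_smul]; abel
      _ = _ := by rw [hxe]
  simp only at h
  rw [h2, map_sub, map_smul] at h
  simp only [sub_apply, FunLike.coe_smul, Pi.smul_apply]
  nth_rewrite 1 [← h]
  abel

/-- The complement of the half-line `[0, ∞)` in `ℂ`. -/
def slitSet : Set ℂ := {z | z.im ≠ 0 ∨ z.re < 0}

lemma isOpen_slitSet : IsOpen slitSet :=
  (isOpen_ne.preimage Complex.continuous_im).union (isOpen_Iio.preimage Complex.continuous_re)

variable {α : ℝ}

lemma SemiboundedHypothesis.notMem_opSpectrum (hH : SemiboundedHypothesis H α) {z : ℂ}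
    (hz : z ∈ slitSet) : z ∉ opSpectrum H := by
  intro h
  obtain ⟨x, hx, rfl⟩ := hH.spectrum_subset h
  rcases hz with h | h
  · simp at h
  · simp only [Complex.ofReal_re] at h; exact absurd hx (not_le.2 h)

/-- Near a point of the resolvent set the resolvent is bounded: by the resolvent identity,
`‖R(w)‖ ≤ 2 ‖R(z)‖` as soon as `|z - w| ‖R(z)‖ ≤ 1/2`. -/
lemma norm_resolventOp_le {z w : ℂ} (hz : z ∉ opSpectrum H) (hw : w ∉ opSpectrum H)
    (h : ‖z - w‖ * ‖resolventOp H z‖ ≤ 1 / 2) : ‖resolventOp H w‖ ≤ 2 * ‖resolventOp H z‖ := by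
  have h1 : resolventOp H w = resolventOp H z - (w - z) • (resolventOp H z * resolventOp H w) := by
    rw [← resolventOp_sub hz hw]; abel
  have h2 : ‖resolventOp H w‖ ≤ ‖resolventOp H z‖ + ‖z - w‖ * (‖resolventOp H z‖ * ‖resolventOp H
      w‖) := by
    nth_rewrite 1 [h1]
    refine (norm_sub_le _ _).trans (add_le_add le_rfl ?_)
    rw [norm_smul, norm_sub_rev w z]
    gcongr
    exact norm_mul_le _ _
  have := norm_nonneg (resolventOp H w)
  nlinarith

lemma SemiboundedHypothesis.continuousAt_resolventOp (hH : SemiboundedHypothesis H α) {z : ℂ}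
    (hz : z ∈ slitSet) : ContinuousAt (resolventOp H) z := by
  have hzs := hH.notMem_opSpectrum hz
  set K := ‖resolventOp H z‖
  have hev : ∀ᶠ w in 𝓝 z, ‖resolventOp H w - resolventOp H z‖ ≤ ‖z - w‖ * (2 * K * K) := by
    have h1 : ∀ᶠ w in 𝓝 z, ‖z - w‖ * K < 1 / 2 := by
      have : ContinuousAt (fun w => ‖z - w‖ * K) z := by fun_prop
      exact this.eventually_lt continuousAt_const (by simp)
    filter_upwards [h1, isOpen_slitSet.mem_nhds hz] with w hw hws
    have hws' := hH.notMem_opSpectrum hws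
    rw [resolventOp_sub hws' hzs, norm_smul]
    gcongr
    refine (norm_mul_le _ _).trans ?_
    exact mul_le_mul_of_nonneg_right (norm_resolventOp_le hzs hws' hw.le) (norm_nonneg _)
  rw [ContinuousAt, tendsto_iff_norm_sub_tendsto_zero]
  refine squeeze_zero' (Eventually.of_forall fun _ => norm_nonneg _) hev ?_
  have : ContinuousAt (fun w => ‖z - w‖ * (2 * K * K)) z := by fun_prop
  simpa [ContinuousAt] using this

lemma SemiboundedHypothesis.differentiableAt_resolventOp (hH : SemiboundedHypothesis H α) {z : ℂ}
    (hz : z ∈ slitSet) : DifferentiableAt ℂ (resolventOp H) z := by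
  have hzs := hH.notMem_opSpectrum hz
  have h : HasDerivAt (resolventOp H) (-(resolventOp H z * resolventOp H z)) z := by
    rw [hasDerivAt_iff_tendsto_slope]
    have hc : Tendsto (fun w => -(resolventOp H w * resolventOp H z)) (𝓝[≠] z)
        (𝓝 (-(resolventOp H z * resolventOp H z))) :=
      (((hH.continuousAt_resolventOp hz).tendsto.mul_const _).neg).mono_left nhdsWithin_le_nhds
    refine hc.congr' ?_
    filter_upwards [self_mem_nhdsWithin,
      nhdsWithin_le_nhds (isOpen_slitSet.mem_nhds hz)] with w hw hws
    have hne : w - z ≠ 0 := sub_ne_zero.2 hw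
    rw [slope_def_module, resolventOp_sub (hH.notMem_opSpectrum hws) hzs, smul_smul,
      ← neg_sub w z, mul_neg, inv_mul_cancel₀ hne, neg_one_smul]
  exact h.differentiableAt

lemma SemiboundedHypothesis.differentiableOn_resolventOp (hH : SemiboundedHypothesis H α) :
    DifferentiableOn ℂ (resolventOp H) slitSet := fun _ hz =>
  (hH.differentiableAt_resolventOp hz).differentiableWithinAt

lemma ae_im_ne_zero : ∀ᵐ z : ℂ, z.im ≠ 0 := by
  have h : ∀ᵐ p : ℝ × ℝ, p.2 ≠ 0 := by
    have : (volume : Measure (ℝ × ℝ)) = (volume : Measure ℝ).prod volume := rfl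
    rw [this]
    refine (Measure.ae_prod_iff_ae_ae ?_).2 (Eventually.of_forall fun x => ?_)
    · exact (measurableSet_singleton (0 : ℝ)).compl.preimage measurable_snd
    · exact Measure.ae_ne volume (0 : ℝ)
  exact Complex.volume_preserving_equiv_real_prod.quasiMeasurePreserving.ae h

lemma SemiboundedHypothesis.aestronglyMeasurable_resolventOp (hH : SemiboundedHypothesis H α) :
    AEStronglyMeasurable (resolventOp H) := by
  have h : AEStronglyMeasurable (resolventOp H) (volume.restrict slitSet) :=
    hH.differentiableOn_resolventOp.continuousOn.aestronglyMeasurable isOpen_slitSet.measurableSet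
  have h2 : (volume : Measure ℂ).restrict slitSet = volume := by
    refine Measure.restrict_eq_self_of_ae_mem ?_
    filter_upwards [ae_im_ne_zero] with z hz using Or.inl hz
  rwa [h2] at h

/-- The resolvent bound with a nonnegative constant. -/
lemma SemiboundedHypothesis.exists_bound (hH : SemiboundedHypothesis H α) :
    ∃ c : ℝ, 0 ≤ c ∧ ∀ z : ℂ, z.im ≠ 0 →
      ‖resolventOp H z‖ ≤ c * |z.im|⁻¹ * (bracket z / |z.im|) ^ α := by
  obtain ⟨c, hc⟩ := hH.resolvent_bound
  refine ⟨|c|, abs_nonneg c, fun z hz => (hc z hz).trans ?_⟩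
  have := bracket_pos z
  gcongr
  exact le_abs_self c

end Resolvent

/-! ### The operator `∂/∂z̄` -/

section Dbar

variable {E : Type*} [NormedAddCommGroup E] [NormedSpace ℂ E]

/-- `∂F/∂z̄` for functions with values in a complex normed space. -/
noncomputable def dbar (F : ℂ → E) (z : ℂ) : E :=
  (2⁻¹ : ℂ) • (fderiv ℝ F z 1 + Complex.I • fderiv ℝ F z Complex.I)

lemma wirtingerBar_eq_dbar (F : ℂ → ℂ) : wirtingerBar F = dbar F := by
  ext z; simp [wirtingerBar, dbar]; ring

lemma dbar_congr {F G : ℂ → E} {z : ℂ} (h : F =ᶠ[𝓝 z] G) : dbar F z = dbar G z := by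
  rw [dbar, dbar, h.fderiv_eq]

lemma dbar_eq_zero_of_differentiableAt {F : ℂ → E} {z : ℂ} (h : DifferentiableAt ℂ F z) :
    dbar F z = 0 := by
  have h1 := h.fderiv_restrictScalars ℝ
  have h2 : fderiv ℝ F z Complex.I = Complex.I • fderiv ℝ F z 1 := by
    rw [h1]
    simp only [ContinuousLinearMap.coe_restrictScalars']
    rw [← map_smul, smul_eq_mul, mul_one]
  rw [dbar, h2, smul_smul, Complex.I_mul_I]
  simp

lemma dbar_smul {φ : ℂ → ℂ} {G : ℂ → E} {z : ℂ} (hφ : DifferentiableAt ℝ φ z)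
    (hG : DifferentiableAt ℝ G z) :
    dbar (fun w => φ w • G w) z = dbar φ z • G z + φ z • dbar G z := by
  have h := (hφ.hasFDerivAt.fun_smul hG.hasFDerivAt).fderiv
  simp only [dbar, h, add_apply, smul_apply,
    ContinuousLinearMap.smulRight_apply]
  module

lemma dbar_smul_of_differentiableAt {φ : ℂ → ℂ} {G : ℂ → E} {z : ℂ} (hφ : DifferentiableAt ℝ φ z)
    (hG : DifferentiableAt ℂ G z) :
    dbar (fun w => φ w • G w) z = dbar φ z • G z := by
  rw [dbar_smul hφ (hG.restrictScalars ℝ), dbar_eq_zero_of_differentiableAt hG, smul_zero, add_zero]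

lemma dbar_mul {φ ψ : ℂ → ℂ} {z : ℂ} (hφ : DifferentiableAt ℝ φ z)
    (hψ : DifferentiableAt ℝ ψ z) :
    dbar (fun w => φ w * ψ w) z = dbar φ z * ψ z + φ z * dbar ψ z :=
  dbar_smul hφ hψ

lemma dbar_sub {F G : ℂ → E} {z : ℂ} (hF : DifferentiableAt ℝ F z) (hG : DifferentiableAt ℝ G z) :
    dbar (fun w => F w - G w) z = dbar F z - dbar G z := by
  simp only [dbar, fderiv_fun_sub hF hG, sub_apply]
  module

lemma norm_dbar_le (F : ℂ → E) (z : ℂ) : ‖dbar F z‖ ≤ ‖fderiv ℝ F z‖ := by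
  have h1 := (fderiv ℝ F z).le_opNorm 1
  have h2 := (fderiv ℝ F z).le_opNorm Complex.I
  rw [norm_one, mul_one] at h1
  rw [Complex.norm_I, mul_one] at h2
  rw [dbar, norm_smul, norm_inv, Complex.norm_ofNat]
  have h3 := norm_add_le (fderiv ℝ F z 1) (Complex.I • fderiv ℝ F z Complex.I)
  rw [norm_smul, Complex.norm_I, one_mul] at h3
  linarith

lemma continuous_dbar {F : ℂ → E} (hF : ContDiff ℝ 1 F) : Continuous (dbar F) := by
  have h := hF.continuous_fderiv (by norm_num)
  unfold dbar
  fun_prop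

lemma hasCompactSupport_dbar {F : ℂ → E} (hF : HasCompactSupport F) :
    HasCompactSupport (dbar F) := by
  refine hF.mono' (fun z hz => ?_)
  by_contra h
  have h0 : F =ᶠ[𝓝 z] fun _ => 0 := notMem_tsupport_iff_eventuallyEq.1 h
  exact hz (by rw [dbar_congr h0]; simp [dbar])

end Dbar

/-! ### Almost analytic extensions -/

section Extension

variable {N : ℕ} {τ : ℂ → ℝ} {f : ℝ → ℂ}

/-- The polynomial part `∑_{r ≤ N} f⁽ʳ⁾(x) (iy)^r / r!` of the almost analytic extension. -/
noncomputable def taylorPart (N : ℕ) (f : ℝ → ℂ) (z : ℂ) : ℂ :=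
  ∑ r ∈ Finset.range (N + 1),
    iteratedDeriv r f z.re * (Complex.I * (z.im : ℂ)) ^ r / (r.factorial : ℂ)

lemma almostAnalyticExt_eq (z : ℂ) :
    almostAnalyticExt N τ f z = taylorPart N f z * (τ z : ℂ) := rfl

lemma contDiff_iteratedDeriv (hf : ContDiff ℝ ∞ f) (r : ℕ) : ContDiff ℝ ∞ (iteratedDeriv r f) := by
  rw [iteratedDeriv_eq_iterate]
  exact hf.iterate_deriv r

lemma contDiff_taylorPart (hf : ContDiff ℝ ∞ f) : ContDiff ℝ ∞ (taylorPart N f) := by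
  unfold taylorPart
  refine ContDiff.sum fun r _ => ?_
  have h1 : ContDiff ℝ ∞ fun z : ℂ => iteratedDeriv r f z.re :=
    (contDiff_iteratedDeriv hf r).comp Complex.reCLM.contDiff
  have h2 : ContDiff ℝ ∞ fun z : ℂ => (z.im : ℂ) :=
    Complex.ofRealCLM.contDiff.comp Complex.imCLM.contDiff
  exact (h1.mul ((contDiff_const.mul h2).pow r)).div_const _

lemma IsCutoff.contDiff_ofReal (hτ : IsCutoff τ) : ContDiff ℝ ∞ fun z => (τ z : ℂ) :=
  Complex.ofRealCLM.contDiff.comp hτ.smooth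

lemma contDiff_almostAnalyticExt (hτ : IsCutoff τ) (hf : ContDiff ℝ ∞ f) :
    ContDiff ℝ ∞ (almostAnalyticExt N τ f) :=
  (contDiff_taylorPart hf).mul hτ.contDiff_ofReal

lemma almostAnalyticExt_eventuallyEq {g : ℝ → ℂ} {z : ℂ} (h : f =ᶠ[𝓝 z.re] g) :
    almostAnalyticExt N τ f =ᶠ[𝓝 z] almostAnalyticExt N τ g := by
  have h1 := Complex.continuous_re.continuousAt.eventually h.eventuallyEq_nhds
  filter_upwards [h1] with w hw
  have : ∀ r, iteratedDeriv r f w.re = iteratedDeriv r g w.re := fun r => hw.iteratedDeriv_eq r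
  simp [almostAnalyticExt, this]

/-- Each term of the sum `∂/∂z̄` of the polynomial part telescopes, so that only the
top-order term remains. -/
lemma dbar_taylorPart (hf : ContDiff ℝ ∞ f) (z : ℂ) :
    dbar (taylorPart N f) z =
      2⁻¹ * (iteratedDeriv (N + 1) f z.re * (Complex.I * (z.im : ℂ)) ^ N / (N.factorial : ℂ)) := by
  let T : ℕ → ℂ → ℂ := fun r z =>
    iteratedDeriv r f z.re * (Complex.I * (z.im : ℂ)) ^ r / (r.factorial : ℂ)
  have hA : ∀ r, HasFDerivAt (fun z : ℂ => iteratedDeriv r f z.re)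
      (Complex.reCLM.smulRight (iteratedDeriv (r + 1) f z.re)) z := fun r => by
    have h1 : HasDerivAt (iteratedDeriv r f) (iteratedDeriv (r + 1) f z.re) z.re := by
      rw [iteratedDeriv_succ]
      exact ((contDiff_iteratedDeriv hf r).differentiable (by simp)).differentiableAt.hasDerivAt
    exact h1.hasFDerivAt.comp z Complex.reCLM.hasFDerivAt
  have hY : HasFDerivAt (fun z : ℂ => Complex.I * (z.im : ℂ))
      (Complex.I • (Complex.ofRealCLM.comp Complex.imCLM)) z :=
    (Complex.ofRealCLM.comp Complex.imCLM).hasFDerivAt.const_mul Complex.I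
  have hT : ∀ r, DifferentiableAt ℝ (T r) z := fun r => by
    have h : HasFDerivAt (T r) _ z := ((hA r).mul (hY.pow r)).mul_const (r.factorial : ℂ)⁻¹
    exact h.differentiableAt
  have key : ∀ r, dbar (T r) z = 2⁻¹ *
      (iteratedDeriv (r + 1) f z.re * (Complex.I * (z.im : ℂ)) ^ r / (r.factorial : ℂ)
        - (r : ℂ) * (iteratedDeriv r f z.re * (Complex.I * (z.im : ℂ)) ^ (r - 1)
          / (r.factorial : ℂ))) := fun r => by
    have h : HasFDerivAt (T r) _ z := ((hA r).mul (hY.pow r)).mul_const (r.factorial : ℂ)⁻¹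
    rw [dbar, h.fderiv]
    simp
    ring_nf
    rw [show Complex.I ^ 2 = -1 from Complex.I_sq]
    ring
  have hsum : ∀ n, dbar (fun z => ∑ r ∈ Finset.range (n + 1), T r z) z =
      2⁻¹ * (iteratedDeriv (n + 1) f z.re * (Complex.I * (z.im : ℂ)) ^ n / (n.factorial : ℂ)) := by
    intro n
    induction n with
    | zero => simpa using key 0
    | succ n ih =>
      have : dbar (fun z => ∑ r ∈ Finset.range (n + 1 + 1), T r z) z =
          dbar (fun z => ∑ r ∈ Finset.range (n + 1), T r z) z + dbar (T (n + 1)) z := by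
        simp only [Finset.sum_range_succ _ (n + 1)]
        have hd : DifferentiableAt ℝ (fun z => ∑ r ∈ Finset.range (n + 1), T r z) z :=
          DifferentiableAt.fun_sum fun r _ => hT r
        simp only [dbar, fderiv_fun_add hd (hT (n + 1)), add_apply]
        module
      rw [this, ih, key, Nat.factorial_succ]
      push_cast
      have h1 : ((n.factorial : ℕ) : ℂ) ≠ 0 := by exact_mod_cast n.factorial_ne_zero
      have h2 : ((n : ℂ) + 1) ≠ 0 := by exact_mod_cast n.succ_ne_zero
      field_simp
      ring
  exact hsum N

lemma dbar_almostAnalyticExt (hτ : IsCutoff τ) (hf : ContDiff ℝ ∞ f) (z : ℂ) :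
    dbar (almostAnalyticExt N τ f) z =
      2⁻¹ * (iteratedDeriv (N + 1) f z.re * (Complex.I * (z.im : ℂ)) ^ N / (N.factorial : ℂ)) * τ z
        + taylorPart N f z * dbar (fun w => (τ w : ℂ)) z := by
  rw [← dbar_taylorPart hf]
  exact dbar_mul ((contDiff_taylorPart hf).differentiable (by simp) z)
    (hτ.contDiff_ofReal.differentiable (by simp) z)

end Extension

/-! ### Integrability of the Helffer–Sjöstrand integrand -/

/-- The dominating function `⟨x⟩^{β - 2 - p} |y|^p 1_{|y| ≤ 2⟨x⟩}`. -/
noncomputable def weight (β p : ℝ) (z : ℂ) : ℝ :=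
  if |z.im| ≤ 2 * bracket z.re then bracket z.re ^ (β - 2 - p) * |z.im| ^ p else 0

lemma weight_nonneg (β p : ℝ) (z : ℂ) : 0 ≤ weight β p z := by
  have := bracket_pos z.re
  unfold weight
  split_ifs <;> positivity

lemma integrable_abs_rpow_near_zero {p : ℝ} (hp : -1 < p) :
    Integrable fun v : ℝ => if |v| ≤ 2 then |v| ^ p else 0 := by
  have h1 : IntervalIntegrable (fun v : ℝ => |v| ^ p) volume 0 2 := by
    refine (intervalIntegral.intervalIntegrable_rpow' hp).congr fun v hv => ?_
    rw [uIoc_of_le (by norm_num)] at hv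
    simp [abs_of_pos hv.1]
  have h2 : IntervalIntegrable (fun v : ℝ => |v| ^ p) volume (-2) 0 := by
    have := (IntervalIntegrable.iff_comp_neg (f := fun v : ℝ => |v| ^ p)).1 h1
    simpa using this.symm
  have h3 := (intervalIntegrable_iff_integrableOn_Icc_of_le (by norm_num)).1 (h2.trans h1)
  refine (h3.integrable_indicator measurableSet_Icc).congr (Eventually.of_forall fun v => ?_)
  simp only [indicator, mem_Icc, ← abs_le]

lemma integrable_bracket_rpow {s : ℝ} (hs : s < -1) : Integrable fun x : ℝ => bracket x ^ s := by
  have h : Integrable fun x : ℝ => ((1 : ℝ) + ‖x‖ ^ 2) ^ (-(-s) / 2) :=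
    integrable_rpow_neg_one_add_norm_sq (by simp; linarith)
  refine h.congr (Eventually.of_forall fun x => ?_)
  simp only [bracket, Real.sqrt_eq_rpow, neg_neg]
  rw [← Real.rpow_mul (by positivity)]
  congr 1; ring

/-- After the substitution `y = ⟨x⟩ v` the inner integral is a constant times `⟨x⟩^{β - 1}`. -/
lemma integrable_weight {β p : ℝ} (hβ : β < 0) (hp : -1 < p) : Integrable (weight β p) := by
  let G : ℝ × ℝ → ℝ := fun q =>
    if |q.2| ≤ 2 * bracket q.1 then bracket q.1 ^ (β - 2 - p) * |q.2| ^ p else 0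
  let k : ℝ → ℝ := fun v => if |v| ≤ 2 then |v| ^ p else 0
  have hk : Integrable k := integrable_abs_rpow_near_zero hp
  have hscale : ∀ x v, G (x, bracket x * v) = bracket x ^ (β - 2) * k v := by
    intro x v
    have hb := bracket_pos x
    have : |bracket x * v| ≤ 2 * bracket x ↔ |v| ≤ 2 := by
      rw [abs_mul, abs_of_pos hb, mul_comm 2, mul_le_mul_iff_right₀ hb]
    simp only [G, k, this]
    split_ifs
    · rw [abs_mul, abs_of_pos hb, Real.mul_rpow hb.le (abs_nonneg _), ← mul_assoc,
        ← Real.rpow_add hb]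
      congr 2; ring
    · simp
  have hG0 : ∀ q, 0 ≤ G q := fun q => by
    have := bracket_pos q.1
    simp only [G]
    split_ifs <;> positivity
  have hm : AEStronglyMeasurable G := by
    have hb : Measurable fun q : ℝ × ℝ => bracket q.1 := by
      exact continuous_bracket.measurable.comp measurable_fst
    have ha : Measurable fun q : ℝ × ℝ => |q.2| := by
      exact continuous_abs.measurable.comp measurable_snd
    refine (Measurable.ite (measurableSet_le ha (hb.const_mul 2))
      ((hb.pow_const _).mul (ha.pow_const _)) measurable_const).aestronglyMeasurable
  have hG : Integrable G := by
    refine (integrable_prod_iff hm).2 ⟨Eventually.of_forall fun x => ?_, ?_⟩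
    · refine (integrable_comp_mul_left_iff _ (bracket_pos x).ne').1 ?_
      simp only [hscale]
      exact hk.const_mul _
    · have hint : ∀ x, ∫ y, ‖G (x, y)‖ = (∫ v, k v) * bracket x ^ (β - 1) := fun x => by
        have hb := bracket_pos x
        have h := Measure.integral_comp_mul_left (fun y => G (x, y)) (bracket x)
        simp only [hscale, integral_const_mul, smul_eq_mul] at h
        rw [abs_of_pos (inv_pos.2 hb)] at h
        simp only [Real.norm_of_nonneg (hG0 _)]
        have h2 : ∫ y, G (x, y) = bracket x * (bracket x ^ (β - 2) * ∫ v, k v) := by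
          rw [h, mul_inv_cancel_left₀ hb.ne']
        rw [h2, show β - 1 = 1 + (β - 2) by ring, Real.rpow_add hb, Real.rpow_one]
        ring
      simp only [hint]
      exact (integrable_bracket_rpow (by linarith)).const_mul _
  exact (Complex.volume_preserving_equiv_real_prod.integrable_comp_emb
    Complex.measurableEquivRealProd.measurableEmbedding).2 hG

section Cutoff

variable {τ : ℂ → ℝ}

/-- A cutoff is bounded: on `⟨x⟩ ≤ |y| ≤ 2⟨x⟩` by the mean value inequality on a vertical segment
that ends where the cutoff vanishes. -/
lemma IsCutoff.exists_bound (hτ : IsCutoff τ) : ∃ C : ℝ, 0 ≤ C ∧ (∀ z, |τ z| ≤ C) ∧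
    ∀ z, ‖fderiv ℝ τ z‖ ≤ C / bracket z.re := by
  obtain ⟨C, hC⟩ := hτ.deriv_bound
  have hC' : ∀ z, ‖fderiv ℝ τ z‖ ≤ (|C| + 1) / bracket z.re := fun z =>
    (hC z).trans (div_le_div_of_nonneg_right (by linarith [le_abs_self C]) (bracket_pos _).le)
  refine ⟨|C| + 1, by positivity, fun z => ?_, hC'⟩
  have hb := bracket_pos z.re
  rcases le_total |z.im| (bracket z.re) with h1 | h1
  · rw [hτ.eq_one z h1, abs_one]; linarith [abs_nonneg C]
  rcases le_total (2 * bracket z.re) |z.im| with h2 | h2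
  · rw [hτ.eq_zero z h2, abs_zero]; positivity
  obtain ⟨y', hy', hd⟩ : ∃ y' : ℝ, |y'| = 2 * bracket z.re ∧ |z.im - y'| ≤ bracket z.re := by
    rcases le_total 0 z.im with h | h
    · refine ⟨2 * bracket z.re, abs_of_pos (by positivity), ?_⟩
      rw [abs_of_nonneg h] at h1 h2
      rw [abs_le]; constructor <;> linarith
    · refine ⟨-(2 * bracket z.re), by rw [abs_neg, abs_of_pos (by positivity)], ?_⟩
      rw [abs_of_nonpos h] at h1 h2
      rw [abs_le]; constructor <;> linarith
  have hconv : Convex ℝ {w : ℂ | w.re = z.re} := by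
    intro a ha b hb' s t _ _ hst
    simp only [mem_ofPred_eq] at ha hb' ⊢
    simp [ha, hb', ← add_mul, hst]
  have h := hconv.norm_image_sub_le_of_norm_fderiv_le (f := τ) (C := (|C| + 1) / bracket z.re)
    (x := ⟨z.re, y'⟩) (y := z) (fun w _ => hτ.smooth.differentiable (by simp) w)
    (fun w hw => by have := hC' w; rwa [show w.re = z.re from hw] at this) rfl rfl
  rw [hτ.eq_zero ⟨z.re, y'⟩ hy'.ge, sub_zero, Real.norm_eq_abs] at h
  have h3 : ‖z - ⟨z.re, y'⟩‖ = |z.im - y'| := by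
    have : z - ⟨z.re, y'⟩ = ((z.im - y' : ℝ) : ℂ) * Complex.I := by
      apply Complex.ext <;> simp
    rw [this, norm_mul, Complex.norm_I, mul_one, Complex.norm_real, Real.norm_eq_abs]
  rw [h3] at h
  calc _ ≤ _ := h
    _ ≤ (|C| + 1) / bracket z.re * bracket z.re := by gcongr
    _ = _ := div_mul_cancel₀ _ hb.ne'

lemma continuous_re_bracket : Continuous fun z : ℂ => bracket z.re :=
  continuous_bracket.comp Complex.continuous_re

lemma IsCutoff.dbar_eq_zero_of_lt (hτ : IsCutoff τ) {z : ℂ} (h : |z.im| < bracket z.re) :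
    dbar (fun w => (τ w : ℂ)) z = 0 := by
  have hev : (fun w => (τ w : ℂ)) =ᶠ[𝓝 z] fun _ => 1 := by
    have : ∀ᶠ w : ℂ in 𝓝 z, |w.im| < bracket w.re :=
      (isOpen_lt (continuous_abs.comp Complex.continuous_im) continuous_re_bracket).mem_nhds h
    filter_upwards [this] with w hw
    simp [hτ.eq_one w hw.le]
  rw [dbar_congr hev]; simp [dbar]

lemma almostAnalyticExt_eventuallyEq_zero (hτ : IsCutoff τ) (N : ℕ) (f : ℝ → ℂ) {z : ℂ}
    (h : 2 * bracket z.re < |z.im|) : almostAnalyticExt N τ f =ᶠ[𝓝 z] fun _ => 0 := by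
  have : ∀ᶠ w : ℂ in 𝓝 z, 2 * bracket w.re < |w.im| :=
    (isOpen_lt (continuous_re_bracket.const_mul 2)
      (continuous_abs.comp Complex.continuous_im)).mem_nhds h
  filter_upwards [this] with w hw
  simp [almostAnalyticExt, hτ.eq_zero w hw.le]

lemma norm_dbar_ofReal_le (hτ : IsCutoff τ) (z : ℂ) :
    ‖dbar (fun w => (τ w : ℂ)) z‖ ≤ ‖fderiv ℝ τ z‖ := by
  refine (norm_dbar_le _ z).trans ?_
  have h : HasFDerivAt (fun w => (τ w : ℂ)) (Complex.ofRealCLM.comp (fderiv ℝ τ z)) z :=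
    Complex.ofRealCLM.hasFDerivAt.comp z (hτ.smooth.differentiable (by simp) z).hasFDerivAt
  rw [h.fderiv]
  refine ContinuousLinearMap.opNorm_le_bound _ (norm_nonneg _) fun v => ?_
  simpa using (fderiv ℝ τ z).le_opNorm v

lemma norm_I_mul_im_pow (z : ℂ) (r : ℕ) : ‖(Complex.I * (z.im : ℂ)) ^ r‖ = |z.im| ^ r := by
  rw [norm_pow, norm_mul, Complex.norm_I, one_mul, Complex.norm_real, Real.norm_eq_abs]

/-- The basic estimate: `∂f̃/∂z̄` vanishes to order `N` at the real axis. Where the cutoff varies,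
`|y| ≥ ⟨x⟩`, so that the lower powers of `|y| / ⟨x⟩` are dominated by the `N`-th. -/
lemma exists_norm_dbar_almostAnalyticExt_le (hτ : IsCutoff τ) (N : ℕ) :
    ∃ C : ℝ, 0 ≤ C ∧ ∀ (f : ℝ → ℂ) (β K : ℝ), ContDiff ℝ ∞ f → SymBound (N + 1) β K f → ∀ z : ℂ,
      ‖dbar (almostAnalyticExt N τ f) z‖ ≤
        C * K * bracket z.re ^ (β - ((N : ℝ) + 1)) * |z.im| ^ N := by
  obtain ⟨C, hC0, hCτ, hCd⟩ := hτ.exists_bound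
  refine ⟨(N + 2) * C, by positivity, fun f β K hf hK z => ?_⟩
  have hb := bracket_pos z.re
  have hK0 := hK.nonneg
  set b := bracket z.re with hbdef
  set y := |z.im| with hydef
  have hy0 : 0 ≤ y := abs_nonneg _
  set W := b ^ (β - ((N : ℝ) + 1)) * y ^ N with hW
  have hW0 : 0 ≤ W := by positivity
  have hfac : ∀ r : ℕ, (1 : ℝ) ≤ r.factorial := fun r => by exact_mod_cast r.factorial_pos
  have hA : ‖2⁻¹ * (iteratedDeriv (N + 1) f z.re * (Complex.I * (z.im : ℂ)) ^ N / (N.factorial : ℂ))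
      * (τ z : ℂ)‖ ≤ C * K * W := by
    rw [norm_mul, norm_mul, norm_div, norm_mul, norm_I_mul_im_pow, Complex.norm_natCast,
      Complex.norm_real, Real.norm_eq_abs, norm_inv, Complex.norm_ofNat]
    have h1 := hK (N + 1) le_rfl z.re
    push_cast at h1
    have h2 : ‖iteratedDeriv (N + 1) f z.re‖ * y ^ N / N.factorial ≤ K * W := by
      refine (div_le_self (by positivity) (hfac N)).trans ?_
      rw [hW, ← mul_assoc]; gcongr
    have h3 : 0 ≤ K * W := by positivity
    calc _ ≤ 2⁻¹ * (K * W) * C := by gcongr; exact hCτ z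
      _ ≤ C * K * W := by nlinarith
  have hB : ‖taylorPart N f z * dbar (fun w => (τ w : ℂ)) z‖ ≤ (N + 1) * C * K * W := by
    rcases lt_or_ge y b with h | h
    · rw [hτ.dbar_eq_zero_of_lt h, mul_zero, norm_zero]; positivity
    have hP : ‖taylorPart N f z‖ ≤ (N + 1) * (K * (W * b)) := by
      have hterm : ∀ r ∈ Finset.range (N + 1),
          ‖iteratedDeriv r f z.re * (Complex.I * (z.im : ℂ)) ^ r / (r.factorial : ℂ)‖ ≤
            K * (W * b) := fun r hr => by
        have hrN : r ≤ N := by simpa [Nat.lt_succ_iff] using hr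
        rw [norm_div, norm_mul, norm_I_mul_im_pow, Complex.norm_natCast]
        refine (div_le_self (by positivity) (hfac r)).trans ?_
        refine (mul_le_mul_of_nonneg_right (hK r (by omega) z.re) (by positivity)).trans ?_
        rw [mul_assoc]
        refine mul_le_mul_of_nonneg_left ?_ hK0
        have e1 : b ^ (β - (r : ℝ)) * y ^ r = b ^ β * (y / b) ^ r := by
          rw [Real.rpow_sub hb, Real.rpow_natCast, div_pow]; field_simp
        have e2 : W * b = b ^ β * (y / b) ^ N := by
          rw [hW, ← sub_sub, Real.rpow_sub hb, Real.rpow_one, Real.rpow_sub hb, Real.rpow_natCast,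
              div_pow]
          field_simp
        rw [e1, e2]
        gcongr
        exact (one_le_div hb).2 h
      refine (norm_sum_le _ _).trans ((Finset.sum_le_sum hterm).trans ?_)
      simp
    calc _ ≤ (N + 1) * (K * (W * b)) * (C / b) := by
          rw [norm_mul]
          refine mul_le_mul hP ((norm_dbar_ofReal_le hτ z).trans (hCd z)) (norm_nonneg _) (by
              positivity)
      _ = (N + 1) * C * K * W := by field_simp
  rw [dbar_almostAnalyticExt hτ hf]
  refine (norm_add_le _ _).trans ((add_le_add hA hB).trans (le_of_eq ?_))
  rw [hW]; ring

end Cutoff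

section Integrand

variable {B : Type*} [NormedAddCommGroup B] [NormedSpace ℂ B] {H : B →ₗ.[ℂ] B} {α : ℝ}
  {N : ℕ} {τ : ℂ → ℝ}

/-- The resolvent bound on the support of the cutoff, uniformly under small horizontal shifts. -/
lemma SemiboundedHypothesis.exists_bound_shift (hH : SemiboundedHypothesis H α) :
    ∃ c : ℝ, 0 ≤ c ∧ ∀ (z : ℂ) (s : ℝ), z.im ≠ 0 → |z.im| ≤ 2 * bracket z.re → |s| ≤ 1 →
      ‖resolventOp H (z - s)‖ ≤ c * bracket z.re ^ α * |z.im| ^ (-1 - α) := by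
  obtain ⟨c, hc0, hc⟩ := hH.exists_bound
  refine ⟨c * 3 ^ α, by positivity, fun z s hz hzb hs => ?_⟩
  have hb := bracket_pos z.re
  have hy : 0 < |z.im| := abs_pos.2 hz
  have him : (z - s).im = z.im := by simp
  have h := hc (z - s) (by rwa [him])
  rw [him] at h
  -- `|y| ≤ 2⟨x⟩` and `|s| ≤ 1` make `⟨z - s⟩` comparable to `⟨x⟩`
  have hbr : bracket (z - s) ≤ 3 * bracket z.re := by
    refine Real.sqrt_le_iff.2 ⟨by positivity, ?_⟩
    rw [mul_pow, bracket_sq, Complex.sq_norm, Complex.normSq_apply, him]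
    have h1 : z.im ^ 2 ≤ 4 * (1 + z.re ^ 2) := by
      have := bracket_sq z.re
      rw [Real.norm_eq_abs, sq_abs] at this
      have h2 := pow_le_pow_left₀ hy.le hzb 2
      rw [sq_abs] at h2
      nlinarith
    have h3 : s ^ 2 ≤ 1 := by rw [← sq_abs]; nlinarith [abs_nonneg s]
    simp only [Complex.sub_re, Complex.ofReal_re, Real.norm_eq_abs, sq_abs]
    nlinarith [sq_nonneg (z.re + s)]
  refine h.trans ?_
  calc c * |z.im|⁻¹ * (bracket (z - s) / |z.im|) ^ α
      ≤ c * |z.im|⁻¹ * (3 * bracket z.re / |z.im|) ^ α := by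
        have := bracket_pos (z - s)
        have := hH.exponent_nonneg
        gcongr
    _ = _ := by
        rw [Real.div_rpow (by positivity) hy.le, Real.mul_rpow (by norm_num) hb.le,
          sub_eq_add_neg, Real.rpow_add hy, Real.rpow_neg_one, Real.rpow_neg hy.le]
        ring

/-- The integrand, with the resolvent shifted by a small real number, is dominated by an integrable
function that depends on `f` only through the constants in its symbol estimates. -/
lemma exists_norm_smul_resolventOp_le (hH : SemiboundedHypothesis H α) (hτ : IsCutoff τ) (N : ℕ) :
    ∃ C : ℝ, ∀ (f : ℝ → ℂ) (β K : ℝ), ContDiff ℝ ∞ f → SymBound (N + 1) β K f →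
      ∀ (s : ℝ), |s| ≤ 1 → ∀ z : ℂ, z.im ≠ 0 →
      ‖dbar (almostAnalyticExt N τ f) z • resolventOp H (z - s)‖ ≤
        C * K * weight β ((N : ℝ) - 1 - α) z := by
  obtain ⟨C, hC0, hC⟩ := exists_norm_dbar_almostAnalyticExt_le hτ N
  obtain ⟨c, hc0, hc⟩ := hH.exists_bound_shift
  refine ⟨C * c, fun f β K hf hK s hs z hz => ?_⟩
  have hb := bracket_pos z.re
  have hy : 0 < |z.im| := abs_pos.2 hz
  have hK0 := hK.nonneg
  unfold weight
  split_ifs with h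
  · rw [norm_smul]
    refine (mul_le_mul (hC f β K hf hK z) (hc z s hz h hs) (norm_nonneg _) (by positivity)).trans
      (le_of_eq ?_)
    have e1 : bracket z.re ^ (β - 2 - ((N : ℝ) - 1 - α)) =
        bracket z.re ^ (β - ((N : ℝ) + 1)) * bracket z.re ^ α := by
      rw [← Real.rpow_add hb]; congr 1; ring
    have e2 : |z.im| ^ ((N : ℝ) - 1 - α) = |z.im| ^ N * |z.im| ^ (-1 - α) := by
      rw [← Real.rpow_natCast, ← Real.rpow_add hy]; congr 1; ring
    rw [e1, e2]; ring
  · rw [dbar_congr (almostAnalyticExt_eventuallyEq_zero hτ N f (not_le.1 h))]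
    simp [dbar]

lemma hsIntegrand_eq (f : ℝ → ℂ) (z : ℂ) :
    hsIntegrand H N τ f z = dbar (almostAnalyticExt N τ f) z • resolventOp H z := by
  rw [hsIntegrand, wirtingerBar_eq_dbar]

lemma aestronglyMeasurable_smul_resolventOp (hH : SemiboundedHypothesis H α) {φ : ℂ → ℂ}
    (hφ : Continuous φ) (s : ℝ) :
    AEStronglyMeasurable fun z => φ z • resolventOp H (z - s) :=
  hφ.aestronglyMeasurable.smul (hH.aestronglyMeasurable_resolventOp.comp_quasiMeasurePreserving
    (measurePreserving_sub_right volume (s : ℂ)).quasiMeasurePreserving)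

lemma continuous_dbar_almostAnalyticExt (hτ : IsCutoff τ) {f : ℝ → ℂ} (hf : ContDiff ℝ ∞ f) :
    Continuous (dbar (almostAnalyticExt N τ f)) :=
  continuous_dbar ((contDiff_almostAnalyticExt hτ hf).of_le (by exact_mod_cast le_top))

theorem integrable_hsIntegrand (hH : SemiboundedHypothesis H α) (hN : α < (N : ℝ))
    (hτ : IsCutoff τ) {f : ℝ → ℂ} (hf : f ∈ algA) : Integrable (hsIntegrand H N τ f) := by
  obtain ⟨β, hβ, hfβ⟩ := hf
  obtain ⟨K, hK⟩ := exists_symBound hfβ (N + 1)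
  obtain ⟨C, hC⟩ := exists_norm_smul_resolventOp_le hH hτ N
  have hw := (integrable_weight hβ (by linarith : (-1 : ℝ) < (N : ℝ) - 1 - α)).const_mul (C * K)
  have hm := aestronglyMeasurable_smul_resolventOp hH
    (continuous_dbar_almostAnalyticExt (N := N) hτ hfβ.1) 0
  simp only [Complex.ofReal_zero, sub_zero, ← hsIntegrand_eq] at hm
  refine hw.mono' hm ?_
  filter_upwards [ae_im_ne_zero] with z hz
  simpa [hsIntegrand_eq] using hC f β K hfβ.1 hK 0 (by simp) z hz

/-- The functional calculus of a function of `𝒜` is the limit of that of its truncations. -/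
theorem tendsto_hsCalculus_truncate (hH : SemiboundedHypothesis H α) (hN : α < (N : ℝ))
    (hτ : IsCutoff τ) {χ f : ℝ → ℂ} (hχ : IsPlateau χ) (hf : f ∈ algA) :
    Tendsto (fun m => hsCalculus H N τ (truncate χ f m)) atTop (𝓝 (hsCalculus H N τ f)) := by
  obtain ⟨β, hβ, hfβ⟩ := hf
  obtain ⟨K, hK⟩ := exists_symBound_truncate hχ hfβ (N + 1)
  obtain ⟨C, hC⟩ := exists_norm_smul_resolventOp_le hH hτ N
  have hw := (integrable_weight hβ (by linarith : (-1 : ℝ) < (N : ℝ) - 1 - α)).const_mul (C * K)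
  refine Tendsto.const_smul ?_ _
  refine tendsto_integral_of_dominated_convergence _ (fun m => ?_) hw (fun m => ?_) ?_
  · exact (integrable_hsIntegrand hH hN hτ (mem_algA_of_hasCompactSupport
      (contDiff_truncate hχ hfβ.1 m) (hasCompactSupport_truncate hχ m))).1
  · filter_upwards [ae_im_ne_zero] with z hz
    simpa [hsIntegrand_eq] using hC _ β K (contDiff_truncate hχ hfβ.1 m) (hK m) 0 (by simp) z hz
  -- pointwise, the integrand is eventually constant in `m`
  · refine Eventually.of_forall fun z => tendsto_const_nhds.congr' ?_
    filter_upwards [eventually_truncate_eq (f := f) hχ z.re] with m hm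
    rw [hsIntegrand_eq, hsIntegrand_eq, dbar_congr (almostAnalyticExt_eventuallyEq hm)]

end Integrand

/-! ### Stokes' theorem and independence of the extension -/

section Stokes

variable {E : Type*} [NormedAddCommGroup E] [NormedSpace ℂ E]

lemma integral_fderiv_eq_zero {F : ℂ → E} (hF : ContDiff ℝ 1 F) (hc : HasCompactSupport F) (v : ℂ) :
    ∫ z, fderiv ℝ F z v = 0 := by
  have hcont : Continuous fun z => fderiv ℝ F z v :=
    (hF.continuous_fderiv (by norm_num)).clm_apply continuous_const
  have hcs : HasCompactSupport fun z => fderiv ℝ F z v := hc.fderiv_apply ℝ v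
  have h := integral_smul_fderiv_eq_neg_fderiv_smul_of_integrable (𝕜 := ℝ) (μ := (volume : Measure
      ℂ))
    (f := fun _ : ℂ => (1 : ℝ)) (g := F) (v := v) (by simp)
    (by simpa using hcont.integrable_of_hasCompactSupport hcs)
    (by simpa using hF.continuous.integrable_of_hasCompactSupport hc)
    (fun _ _ => by fun_prop) (fun z _ => hF.differentiable (by norm_num) z)
  simpa using h

lemma integral_dbar_eq_zero {F : ℂ → E} (hF : ContDiff ℝ 1 F) (hc : HasCompactSupport F) :
    ∫ z, dbar F z = 0 := by
  have hint : ∀ v : ℂ, Integrable fun z => fderiv ℝ F z v := fun v =>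
    ((hF.continuous_fderiv (by norm_num)).clm_apply
      continuous_const).integrable_of_hasCompactSupport (hc.fderiv_apply ℝ v)
  unfold dbar
  rw [integral_smul, integral_add (hint 1)
    (show Integrable fun z => Complex.I • fderiv ℝ F z Complex.I from (hint Complex.I).smul
        Complex.I), integral_smul,
    integral_fderiv_eq_zero hF hc, integral_fderiv_eq_zero hF hc, smul_zero, add_zero, smul_zero]

/-- If `G` is holomorphic near the support of `φ`, then `∫ (∂φ/∂z̄) G = ∫ ∂(φ G)/∂z̄ = 0`. -/
lemma integral_dbar_smul_eq_zero [CompleteSpace E] {φ : ℂ → ℂ} {G : ℂ → E} {U : Set ℂ}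
    (hφ : ContDiff ℝ ∞ φ) (hc : HasCompactSupport φ) (hU : IsOpen U) (hsub : tsupport φ ⊆ U)
    (hG : DifferentiableOn ℂ G U) : ∫ z, dbar φ z • G z = 0 := by
  have hφ1 : ContDiff ℝ 1 φ := hφ.of_le (by exact_mod_cast le_top)
  have hoff : ∀ z ∉ tsupport φ, (fun w => φ w • G w) =ᶠ[𝓝 z] fun _ => 0 := fun z hz => by
    filter_upwards [notMem_tsupport_iff_eventuallyEq.1 hz] with w hw
    simp [hw]
  have hF : ContDiff ℝ 1 fun w => φ w • G w := by
    rw [contDiff_iff_contDiffAt]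
    intro z
    by_cases hz : z ∈ tsupport φ
    · have h1 : ContDiffAt ℂ 1 G z :=
        (hG.contDiffOn hU).contDiffAt (hU.mem_nhds (hsub hz))
      exact hφ1.contDiffAt.smul (h1.restrict_scalars ℝ)
    · exact contDiffAt_const.congr_of_eventuallyEq (hoff z hz)
  rw [← integral_dbar_eq_zero hF (hc.smul_right (f' := G))]
  congr 1
  ext z
  by_cases hz : z ∈ tsupport φ
  · rw [dbar_smul_of_differentiableAt (hφ1.differentiable (by norm_num) z)
      (hG.differentiableAt (hU.mem_nhds (hsub hz)))]
  · rw [dbar_congr (hoff z hz), dbar_congr (notMem_tsupport_iff_eventuallyEq.1 hz)]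
    simp [dbar]

end Stokes

section Independence

variable {B : Type*} [NormedAddCommGroup B] [NormedSpace ℂ B] {H : B →ₗ.[ℂ] B} {α : ℝ}
  {N : ℕ} {τ : ℂ → ℝ}

lemma almostAnalyticExt_zero (z : ℂ) : almostAnalyticExt N τ (fun _ => 0) z = 0 := by
  simp [almostAnalyticExt, iteratedDeriv_fun_const_zero]

lemma hasCompactSupport_almostAnalyticExt (hτ : IsCutoff τ) {f : ℝ → ℂ} (hc : HasCompactSupport f) :
    HasCompactSupport (almostAnalyticExt N τ f) := by
  obtain ⟨R, hR⟩ := hc.isBounded.subset_closedBall 0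
  refine HasCompactSupport.intro (isCompact_closedBall (0 : ℂ) (R + 2 * (1 + R))) fun z hz => ?_
  by_cases h1 : z.re ∈ tsupport f
  · have h2 : |z.re| ≤ R := by simpa using hR h1
    refine (almostAnalyticExt_eventuallyEq_zero hτ N f ?_).eq_of_nhds
    by_contra h3
    refine hz ?_
    have h4 := bracket_le_one_add_norm z.re
    rw [Real.norm_eq_abs] at h4
    have h5 := Complex.norm_le_abs_re_add_abs_im z
    rw [mem_closedBall_zero_iff]
    linarith [not_lt.1 h3]
  · have h := almostAnalyticExt_eventuallyEq (N := N) (τ := τ) (notMem_tsupport_iff_eventuallyEq.1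
      h1)
    rw [h.eq_of_nhds]
    exact almostAnalyticExt_zero z

lemma hsCalculus_sub (hH : SemiboundedHypothesis H α) (hN : α < (N : ℝ))
    (hτ : IsCutoff τ) {f g : ℝ → ℂ} (hf : f ∈ algA) (hg : g ∈ algA) :
    hsCalculus H N τ (fun x => f x - g x) = hsCalculus H N τ f - hsCalculus H N τ g := by
  have hf' := algA.contDiff hf
  have hg' := algA.contDiff hg
  have hext : almostAnalyticExt N τ (fun x => f x - g x) =
      fun z => almostAnalyticExt N τ f z - almostAnalyticExt N τ g z := by
    ext z
    have : ∀ r, iteratedDeriv r (fun x => f x - g x) z.re =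
        iteratedDeriv r f z.re - iteratedDeriv r g z.re := fun r =>
      iteratedDeriv_fun_sub (hf'.contDiffAt.of_le (by exact_mod_cast le_top))
        (hg'.contDiffAt.of_le (by exact_mod_cast le_top))
    simp only [almostAnalyticExt, this, sub_mul, sub_div, Finset.sum_sub_distrib]
  rw [hsCalculus, hsCalculus, hsCalculus, ← smul_sub,
    ← integral_sub (integrable_hsIntegrand hH hN hτ hf) (integrable_hsIntegrand hH hN hτ hg)]
  congr 2
  ext1 z
  rw [hsIntegrand_eq, hsIntegrand_eq, hsIntegrand_eq, hext,
    dbar_sub ((contDiff_almostAnalyticExt hτ hf').differentiable (by simp) z)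
      ((contDiff_almostAnalyticExt hτ hg').differentiable (by simp) z), sub_smul]

variable [CompleteSpace B]

/-- For `h` vanishing on `[0, ∞)`, the shifted resolvent `(z - ε - H)⁻¹` is holomorphic near the
support of `h̃`, so that Stokes' theorem applies to it; then `ε → 0`. -/
lemma hsCalculus_eq_zero_of_hasCompactSupport (hH : SemiboundedHypothesis H α) (hN : α < (N : ℝ))
    (hτ : IsCutoff τ) {h : ℝ → ℂ} (hs : ContDiff ℝ ∞ h) (hc : HasCompactSupport h)
    (h0 : ∀ x, 0 ≤ x → h x = 0) : hsCalculus H N τ h = 0 := by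
  set F := almostAnalyticExt N τ h
  have hFsupp : tsupport F ⊆ {z | z.re ≤ 0} := by
    refine closure_minimal (fun z hz => ?_) (isClosed_le Complex.continuous_re continuous_const)
    by_contra hre
    have hev : h =ᶠ[𝓝 z.re] fun _ => 0 := by
      filter_upwards [Ioi_mem_nhds (not_le.1 hre)] with x hx using h0 x (le_of_lt hx)
    refine hz ?_
    change almostAnalyticExt N τ h z = 0
    rw [(almostAnalyticExt_eventuallyEq (N := N) (τ := τ) hev).eq_of_nhds]
    exact almostAnalyticExt_zero z
  let ε : ℕ → ℝ := fun m => 1 / ((m : ℝ) + 1)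
  have hε0 : ∀ m, 0 < ε m := fun m => Nat.one_div_pos_of_nat
  have hε1 : ∀ m, |ε m| ≤ 1 := fun m => by
    rw [abs_of_pos (hε0 m)]
    exact (div_le_one (by positivity)).2 (by linarith [Nat.cast_nonneg (α := ℝ) m])
  have hzero : ∀ m, ∫ z, dbar F z • resolventOp H (z - ε m) = 0 := fun m => by
    refine integral_dbar_smul_eq_zero (U := (fun z : ℂ => z - ε m) ⁻¹' slitSet)
      (contDiff_almostAnalyticExt hτ hs) (hasCompactSupport_almostAnalyticExt hτ hc)
      (isOpen_slitSet.preimage (by fun_prop)) (fun z hz => Or.inr ?_) ?_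
    · have : z.re ≤ 0 := hFsupp hz
      simp only [Complex.sub_re, Complex.ofReal_re]
      linarith [hε0 m]
    · exact hH.differentiableOn_resolventOp.comp (by fun_prop) (mapsTo_preimage _ _)
  have hsym := mem_symbolClass_of_hasCompactSupport hs hc (-1)
  obtain ⟨K, hK⟩ := exists_symBound hsym (N + 1)
  obtain ⟨C, hC⟩ := exists_norm_smul_resolventOp_le hH hτ N
  have hw := (integrable_weight (β := -1) (by norm_num)
    (by linarith : (-1 : ℝ) < (N : ℝ) - 1 - α)).const_mul (C * K)
  have hlim : Tendsto (fun m => ∫ z, dbar F z • resolventOp H (z - ε m)) atTop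
      (𝓝 (∫ z, hsIntegrand H N τ h z)) := by
    refine tendsto_integral_of_dominated_convergence _ (fun m => ?_) hw (fun m => ?_) ?_
    · exact aestronglyMeasurable_smul_resolventOp hH (continuous_dbar_almostAnalyticExt hτ hs) _
    · filter_upwards [ae_im_ne_zero] with z hz using hC h _ K hs hK _ (hε1 m) z hz
    · filter_upwards [ae_im_ne_zero] with z hz
      rw [hsIntegrand_eq]
      refine Tendsto.const_smul ?_ _
      refine (hH.continuousAt_resolventOp (Or.inl hz)).tendsto.comp ?_
      have h1 : Tendsto (fun m => ((ε m : ℝ) : ℂ)) atTop (𝓝 ((0 : ℝ) : ℂ)) :=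
        (Complex.continuous_ofReal.tendsto 0).comp tendsto_one_div_add_atTop_nhds_zero_nat
      simpa using h1.const_sub z
  simp only [hzero] at hlim
  rw [hsCalculus, tendsto_nhds_unique hlim tendsto_const_nhds, smul_zero]

/-- The functional calculus depends only on the values on `[0, ∞)`: the truncations of a function
vanishing there vanish there too. -/
lemma hsCalculus_eq_zero (hH : SemiboundedHypothesis H α) (hN : α < (N : ℝ))
    (hτ : IsCutoff τ) {h : ℝ → ℂ} (hA : h ∈ algA)
    (h0 : ∀ x, 0 ≤ x → h x = 0) : hsCalculus H N τ h = 0 := by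
  obtain ⟨χ, hχ⟩ := exists_isPlateau
  have hlim := tendsto_hsCalculus_truncate hH hN hτ hχ hA
  have : ∀ m, hsCalculus H N τ (truncate χ h m) = 0 := fun m =>
    hsCalculus_eq_zero_of_hasCompactSupport hH hN hτ (contDiff_truncate hχ (algA.contDiff hA) m)
      (hasCompactSupport_truncate hχ m) fun x hx => by rw [truncate, h0 x hx, zero_mul]
  simp only [this] at hlim
  exact tendsto_nhds_unique hlim tendsto_const_nhds

theorem hsCalculus_eq_of_eqOn (hH : SemiboundedHypothesis H α) (hN : α < (N : ℝ))
    (hτ : IsCutoff τ) {f g : ℝ → ℂ} (hf : f ∈ algA) (hg : g ∈ algA) (hfg : EqOn f g (Ici 0)) :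
    hsCalculus H N τ f = hsCalculus H N τ g := by
  rw [← sub_eq_zero, ← hsCalculus_sub hH hN hτ hf hg]
  exact hsCalculus_eq_zero hH hN hτ (algA.sub hf hg) fun x hx => sub_eq_zero.2 (hfg hx)

end Independence

/-! ### A regularized Cauchy kernel -/

section Kernel

open ComplexConjugate

/-- The kernel `ū / (|u|² + δ²)`, a smooth approximation of `1 / u`. -/
noncomputable def regKernel (δ : ℝ) (u : ℂ) : ℂ := conj u * (u * conj u + (δ : ℂ) ^ 2)⁻¹

lemma regKernel_denom (δ : ℝ) (u : ℂ) :
    u * conj u + (δ : ℂ) ^ 2 = ((‖u‖ ^ 2 + δ ^ 2 : ℝ) : ℂ) := by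
  rw [Complex.mul_conj, Complex.normSq_eq_norm_sq]; push_cast; rfl

lemma regKernel_denom_ne_zero {δ : ℝ} (hδ : 0 < δ) (u : ℂ) : u * conj u + (δ : ℂ) ^ 2 ≠ 0 := by
  rw [regKernel_denom, Complex.ofReal_ne_zero]; positivity

lemma contDiff_conj : ContDiff ℝ ∞ fun u : ℂ => conj u := Complex.conjCLE.contDiff

lemma contDiff_regKernel {δ : ℝ} (hδ : 0 < δ) : ContDiff ℝ ∞ (regKernel δ) :=
  contDiff_conj.mul (((contDiff_id.mul contDiff_conj).add contDiff_const).inv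
    (regKernel_denom_ne_zero hδ))

lemma dbar_conj (u : ℂ) : dbar (fun w => conj w) u = 1 := by
  have h : HasFDerivAt (fun w : ℂ => conj w) (Complex.conjCLE : ℂ →L[ℝ] ℂ) u :=
    Complex.conjCLE.hasFDerivAt
  rw [dbar, h.fderiv]
  simp
  norm_num

lemma dbar_regKernel {δ : ℝ} (hδ : 0 < δ) (u : ℂ) :
    dbar (regKernel δ) u = ((δ ^ 2 / (‖u‖ ^ 2 + δ ^ 2) ^ 2 : ℝ) : ℂ) := by
  have hc : DifferentiableAt ℝ (fun w : ℂ => conj w) u := contDiff_conj.differentiable (by simp) u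
  have hD : DifferentiableAt ℝ (fun w : ℂ => w * conj w + (δ : ℂ) ^ 2) u :=
    (differentiableAt_id.mul hc).add_const _
  have hI : DifferentiableAt ℝ (fun w : ℂ => (w * conj w + (δ : ℂ) ^ 2)⁻¹) u :=
    hD.fun_inv (regKernel_denom_ne_zero hδ u)
  have h1 : dbar (fun w : ℂ => w * conj w + (δ : ℂ) ^ 2) u = u := by
    have h2 : dbar (fun w : ℂ => w * conj w + (δ : ℂ) ^ 2) u = dbar (fun w : ℂ => w * conj w) u :=
        by
      simp only [dbar, fderiv_add_const]
    rw [h2, dbar_mul (φ := fun w => w) differentiableAt_id hc, dbar_conj,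
      dbar_eq_zero_of_differentiableAt differentiableAt_fun_id]
    ring
  have h3 : dbar (fun w : ℂ => (w * conj w + (δ : ℂ) ^ 2) * (w * conj w + (δ : ℂ) ^ 2)⁻¹) u = 0 :=
      by
    have : (fun w : ℂ => (w * conj w + (δ : ℂ) ^ 2) * (w * conj w + (δ : ℂ) ^ 2)⁻¹) = fun _ => 1 :=
        by
      ext w; exact mul_inv_cancel₀ (regKernel_denom_ne_zero hδ w)
    rw [this]; simp [dbar]
  rw [dbar_mul hD hI, h1] at h3
  have h4 : dbar (regKernel δ) u = _ := dbar_mul hc hI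
  rw [h4, dbar_conj]
  have hne := regKernel_denom_ne_zero hδ u
  push_cast
  have hden := regKernel_denom δ u
  push_cast at hden
  rw [← hden]
  set D := u * conj u + (δ : ℂ) ^ 2 with hDdef
  have h5 : dbar (fun w : ℂ => (w * conj w + (δ : ℂ) ^ 2)⁻¹) u = -(u * D⁻¹) / D := by
    rw [eq_div_iff hne]; linear_combination h3
  rw [h5]
  field_simp
  rw [hDdef]
  ring

lemma norm_regKernel_le {δ : ℝ} (hδ : 0 < δ) (u : ℂ) : ‖regKernel δ u‖ ≤ δ⁻¹ := by
  rw [regKernel, regKernel_denom, norm_mul, norm_inv, Complex.norm_real, RCLike.norm_conj,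
    Real.norm_of_nonneg (by positivity), ← div_eq_mul_inv, div_le_iff₀ (by positivity),
    inv_mul_eq_div, le_div_iff₀ hδ]
  nlinarith [sq_nonneg (‖u‖ - δ), norm_nonneg u]

lemma regKernel_neg (δ : ℝ) (u : ℂ) : regKernel δ (-u) = -regKernel δ u := by
  simp [regKernel]

lemma mul_regKernel (δ : ℝ) (u : ℂ) :
    u * regKernel δ u = ((‖u‖ ^ 2 / (‖u‖ ^ 2 + δ ^ 2) : ℝ) : ℂ) := by
  rw [regKernel, ← mul_assoc, regKernel_denom, Complex.mul_conj, Complex.normSq_eq_norm_sq,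
    ← div_eq_mul_inv, Complex.ofReal_div]

lemma norm_mul_regKernel_le (δ : ℝ) (u : ℂ) : ‖u * regKernel δ u‖ ≤ 1 := by
  rw [mul_regKernel, Complex.norm_real, Real.norm_of_nonneg (by positivity)]
  exact div_le_one_of_le₀ (by nlinarith [sq_nonneg δ]) (by positivity)

lemma integrable_inv_one_add_norm_sq_sq : Integrable fun u : ℂ => ((1 + ‖u‖ ^ 2) ^ 2)⁻¹ := by
  have h : Integrable fun x : ℂ => ((1 : ℝ) + ‖x‖ ^ 2) ^ (-(4 : ℝ) / 2) :=
    integrable_rpow_neg_one_add_norm_sq (by simp; norm_num)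
  refine h.congr (Eventually.of_forall fun x => ?_)
  simp only
  rw [show (-(4 : ℝ) / 2) = -((2 : ℕ) : ℝ) by norm_num, Real.rpow_neg (by positivity),
    Real.rpow_natCast]

/-- In polar coordinates the integral is `2π ∫₀^∞ r (1 + r²)⁻² dr`. -/
lemma integral_inv_one_add_norm_sq_sq : ∫ u : ℂ, ((1 + ‖u‖ ^ 2) ^ 2)⁻¹ = Real.pi := by
  have h := integral_fun_norm_addHaar (volume : Measure ℂ) (fun r : ℝ => ((1 + r ^ 2) ^ 2)⁻¹)
  rw [h]
  have hd : ∀ x ∈ Ici (0 : ℝ), HasDerivAt (fun r : ℝ => -(2⁻¹ * (1 + r ^ 2)⁻¹))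
      (x ^ (Module.finrank ℝ ℂ - 1) • ((1 + x ^ 2) ^ 2)⁻¹) x := fun x _ => by
    have h1 : HasDerivAt (fun r : ℝ => 1 + r ^ 2) (2 * x) x := by
      simpa using ((hasDerivAt_id x).pow 2).const_add 1
    have h2 := ((h1.fun_inv (by positivity)).const_mul (2⁻¹ : ℝ)).fun_neg
    refine h2.congr_deriv ?_
    rw [Complex.finrank_real_complex, smul_eq_mul, Nat.add_one_sub_one, pow_one]
    field_simp
  have hlim : Tendsto (fun r : ℝ => -(2⁻¹ * (1 + r ^ 2)⁻¹)) atTop (𝓝 0) := by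
    have h1 : Tendsto (fun r : ℝ => 1 + r ^ 2) atTop atTop :=
      tendsto_atTop_add_const_left _ _ (tendsto_pow_atTop two_ne_zero)
    simpa using (h1.inv_tendsto_atTop.const_mul (2⁻¹ : ℝ)).neg
  rw [integral_Ioi_of_hasDerivAt_of_nonneg' hd (fun x hx => by
    have : (0 : ℝ) < x := hx
    positivity) hlim]
  simp [Complex.finrank_real_complex, Measure.real, Complex.volume_ball]
  ring

/-- The approximate Cauchy–Pompeiu formula: integration by parts moves `∂/∂w̄` to the kernel, and
`w = z + δ u` turns the result into an average of `φ` near `z`, of total mass `π`. -/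
lemma integral_dbar_mul_regKernel {φ : ℂ → ℂ} (hφ : ContDiff ℝ ∞ φ) (hc : HasCompactSupport φ)
    {δ : ℝ} (hδ : 0 < δ) (z : ℂ) :
    ∫ w, dbar φ w * regKernel δ (w - z) =
      -∫ u : ℂ, φ (z + δ • u) * (((1 + ‖u‖ ^ 2) ^ 2)⁻¹ : ℝ) := by
  have hk : ContDiff ℝ ∞ fun w => regKernel δ (w - z) :=
    (contDiff_regKernel hδ).comp (contDiff_id.sub contDiff_const)
  have hdk : ∀ w, dbar (fun w => regKernel δ (w - z)) w = dbar (regKernel δ) (w - z) := fun w => by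
    simp only [dbar, fderiv_comp_sub]
  have hone : (1 : WithTop ℕ∞) ≤ ∞ := by exact_mod_cast le_top
  have hφ1 := hφ.of_le hone
  have hk1 := hk.of_le hone
  have h0 := integral_dbar_eq_zero (F := fun w => φ w * regKernel δ (w - z)) (hφ1.mul hk1)
    hc.mul_right
  have hprod : ∀ w, dbar (fun w => φ w * regKernel δ (w - z)) w =
      dbar φ w * regKernel δ (w - z) + φ w * dbar (regKernel δ) (w - z) := fun w => by
    rw [dbar_mul (hφ1.differentiable (by norm_num) w) (hk1.differentiable (by norm_num) w), hdk]
  simp only [hprod] at h0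
  have hi1 : Integrable fun w => dbar φ w * regKernel δ (w - z) :=
    ((continuous_dbar hφ1).mul hk.continuous).integrable_of_hasCompactSupport
      (hasCompactSupport_dbar hc).mul_right
  have hi2 : Integrable fun w => φ w * dbar (regKernel δ) (w - z) := by
    have : Continuous fun w => dbar (regKernel δ) (w - z) :=
      (continuous_dbar ((contDiff_regKernel hδ).of_le hone)).comp (continuous_id.sub
          continuous_const)
    exact (hφ.continuous.mul this).integrable_of_hasCompactSupport hc.mul_right
  rw [integral_add hi1 hi2] at h0
  rw [eq_neg_of_add_eq_zero_left h0]
  congr 1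
  have h1 : ∫ w, φ w * dbar (regKernel δ) (w - z) = ∫ v, φ (z + v) * dbar (regKernel δ) v := by
    rw [← integral_add_left_eq_self _ z]
    simp
  have h2 := Measure.integral_comp_smul (volume : Measure ℂ)
    (fun v => φ (z + v) * dbar (regKernel δ) v) δ
  rw [Complex.finrank_real_complex, abs_of_pos (by positivity)] at h2
  have h3 : ∫ v, φ (z + v) * dbar (regKernel δ) v =
      (δ ^ 2) • ∫ u : ℂ, φ (z + δ • u) * dbar (regKernel δ) (δ • u) := by
    rw [h2, smul_smul, mul_inv_cancel₀ (by positivity), one_smul]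
  rw [h1, h3, ← integral_smul]
  congr 1
  ext u
  rw [dbar_regKernel hδ, norm_smul, Real.norm_of_nonneg hδ.le, Complex.real_smul,
    mul_left_comm, ← Complex.ofReal_mul]
  congr 2
  field_simp
  ring

lemma norm_integral_dbar_mul_regKernel_le {φ : ℂ → ℂ} (hφ : ContDiff ℝ ∞ φ)
    (hc : HasCompactSupport φ) {C : ℝ} (hC : ∀ z, ‖φ z‖ ≤ C) {δ : ℝ} (hδ : 0 < δ) (z : ℂ) :
    ‖∫ w, dbar φ w * regKernel δ (w - z)‖ ≤ C * Real.pi := by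
  rw [integral_dbar_mul_regKernel hφ hc hδ, norm_neg, ← integral_inv_one_add_norm_sq_sq, ←
      integral_const_mul]
  refine norm_integral_le_of_norm_le (integrable_inv_one_add_norm_sq_sq.const_mul C)
      (Eventually.of_forall fun u => ?_)
  rw [norm_mul, Complex.norm_real, Real.norm_of_nonneg (by positivity)]
  gcongr
  exact hC _

lemma tendsto_integral_dbar_mul_regKernel {φ : ℂ → ℂ} (hφ : ContDiff ℝ ∞ φ)
    (hc : HasCompactSupport φ) {δ : ℕ → ℝ} (hδ : ∀ m, 0 < δ m) (hδ0 : Tendsto δ atTop (𝓝 0)) (z :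
        ℂ) :
    Tendsto (fun m => ∫ w, dbar φ w * regKernel (δ m) (w - z)) atTop (𝓝 (-(Real.pi * φ z))) := by
  obtain ⟨C, hC⟩ := hφ.continuous.bounded_above_of_compact_support hc
  simp only [fun m => integral_dbar_mul_regKernel hφ hc (hδ m) z]
  refine Tendsto.neg ?_
  have hval : (Real.pi * φ z : ℂ) = ∫ u : ℂ, φ z * (((1 + ‖u‖ ^ 2) ^ 2)⁻¹ : ℝ) := by
    rw [integral_const_mul, integral_complex_ofReal, integral_inv_one_add_norm_sq_sq, mul_comm]
  rw [hval]
  refine tendsto_integral_of_dominated_convergence (fun u => C * ((1 + ‖u‖ ^ 2) ^ 2)⁻¹)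
    (fun m => ?_) (integrable_inv_one_add_norm_sq_sq.const_mul C) (fun m => Eventually.of_forall
        fun u => ?_)
    (Eventually.of_forall fun u => ?_)
  · refine Continuous.aestronglyMeasurable ?_
    refine (hφ.continuous.comp (by fun_prop)).mul (Complex.continuous_ofReal.comp ?_)
    exact Continuous.inv₀ (by fun_prop) fun u => by positivity
  · rw [norm_mul, Complex.norm_real, Real.norm_of_nonneg (by positivity)]
    gcongr
    exact hC _
  · refine Tendsto.mul_const _ ?_
    have h1 : Tendsto (fun m => z + δ m • u) atTop (𝓝 z) := by
      simpa using (hδ0.smul_const u).const_add z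
    exact (hφ.continuous.tendsto z).comp h1

end Kernel

/-! ### Multiplicativity of the functional calculus -/

section Multiplicativity

variable {B : Type*} [NormedAddCommGroup B] [NormedSpace ℂ B] [CompleteSpace B]
  {H : B →ₗ.[ℂ] B} {α : ℝ} {N : ℕ} {τ : ℂ → ℝ}

/-- The product of two Helffer–Sjöstrand type integrals. With the regularized kernel `k` in place of
`1 / (w - z)`, the resolvent identity turns `R(z) R(w)` into `k(w - z) (R(z) - R(w))`, and the
integral of `∂ψ/∂w̄` (respectively `∂φ/∂z̄`) against `k` tends to `-π ψ(z)` (respectively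
`π φ(w)`). -/
lemma integral_dbar_smul_mul_integral_dbar_smul (hH : SemiboundedHypothesis H α) {φ ψ : ℂ → ℂ}
    (hφ : ContDiff ℝ ∞ φ) (hφc : HasCompactSupport φ) (hψ : ContDiff ℝ ∞ ψ)
    (hψc : HasCompactSupport ψ) (hφR : Integrable fun z => dbar φ z • resolventOp H z)
    (hψR : Integrable fun z => dbar ψ z • resolventOp H z) :
    (∫ z, dbar φ z • resolventOp H z) * (∫ z, dbar ψ z • resolventOp H z) =
      (-(Real.pi : ℂ)) • ∫ z, dbar (fun w => φ w * ψ w) z • resolventOp H z := by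
  have hone : (1 : WithTop ℕ∞) ≤ ∞ := by exact_mod_cast le_top
  set A : ℂ → B →L[ℂ] B := fun z => dbar φ z • resolventOp H z with hA
  set D : ℂ → B →L[ℂ] B := fun z => dbar ψ z • resolventOp H z with hD
  have hcφ : Continuous (dbar φ) := continuous_dbar (hφ.of_le hone)
  have hcψ : Continuous (dbar ψ) := continuous_dbar (hψ.of_le hone)
  have hiφ : Integrable (dbar φ) :=
    hcφ.integrable_of_hasCompactSupport (hasCompactSupport_dbar hφc)
  have hiψ : Integrable (dbar ψ) :=
    hcψ.integrable_of_hasCompactSupport (hasCompactSupport_dbar hψc)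
  let δ : ℕ → ℝ := fun m => 1 / ((m : ℝ) + 1)
  have hδ : ∀ m, 0 < δ m := fun m => Nat.one_div_pos_of_nat
  have hδ0 : Tendsto δ atTop (𝓝 0) := tendsto_one_div_add_atTop_nhds_zero_nat
  have hkc : ∀ m, Continuous fun p : ℂ × ℂ => regKernel (δ m) (p.2 - p.1) := fun m =>
    (contDiff_regKernel (hδ m)).continuous.comp (by fun_prop)
  -- the regularized double integral converges to the product of the two integrals
  have hAD : Integrable (fun p : ℂ × ℂ => A p.1 * D p.2) (volume.prod volume) := hφR.mul_prod hψR
  have hprod : (∫ z, A z) * (∫ w, D w) = ∫ p : ℂ × ℂ, A p.1 * D p.2 ∂(volume.prod volume) := by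
    rw [integral_prod _ hAD, ← integral_mul_const_of_integrable hφR]
    congr 1
    ext1 z
    exact (integral_const_mul_of_integrable hψR).symm
  have hne : ∀ᵐ p : ℂ × ℂ ∂(volume.prod volume), p.2 ≠ p.1 := by
    refine (Measure.ae_prod_iff_ae_ae ?_).2 (Eventually.of_forall fun z => Measure.ae_ne volume z)
    exact (measurableSet_eq_fun measurable_snd measurable_fst).compl
  have him : ∀ᵐ p : ℂ × ℂ ∂(volume.prod volume), p.1.im ≠ 0 ∧ p.2.im ≠ 0 :=
    (Measure.quasiMeasurePreserving_fst.ae ae_im_ne_zero).and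
      (Measure.quasiMeasurePreserving_snd.ae ae_im_ne_zero)
  have hlim1 : Tendsto (fun m => ∫ p : ℂ × ℂ,
      ((p.2 - p.1) * regKernel (δ m) (p.2 - p.1)) • (A p.1 * D p.2) ∂(volume.prod volume)) atTop
      (𝓝 (∫ p : ℂ × ℂ, A p.1 * D p.2 ∂(volume.prod volume))) := by
    refine tendsto_integral_of_dominated_convergence _ (fun m => ?_) hAD.norm (fun m => ?_) ?_
    · have hcont : Continuous fun p : ℂ × ℂ => (p.2 - p.1) * regKernel (δ m) (p.2 - p.1) := by
        have := hkc m
        fun_prop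
      exact hcont.aestronglyMeasurable.smul hAD.1
    · refine Eventually.of_forall fun p => ?_
      rw [norm_smul]
      exact mul_le_of_le_one_left (norm_nonneg _) (norm_mul_regKernel_le _ _)
    · filter_upwards [hne] with p hp
      have h1 : Tendsto (fun m => (p.2 - p.1) * regKernel (δ m) (p.2 - p.1)) atTop (𝓝 1) := by
        have hu : ‖p.2 - p.1‖ ^ 2 ≠ 0 := pow_ne_zero _ (norm_ne_zero_iff.2 (sub_ne_zero.2 hp))
        simp only [mul_regKernel]
        have h2 : Tendsto (fun m => ‖p.2 - p.1‖ ^ 2 / (‖p.2 - p.1‖ ^ 2 + δ m ^ 2)) atTop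
            (𝓝 (‖p.2 - p.1‖ ^ 2 / (‖p.2 - p.1‖ ^ 2 + 0 ^ 2))) :=
          tendsto_const_nhds.div ((hδ0.pow 2).const_add _) (by simpa using hu)
        rw [zero_pow two_ne_zero, add_zero, div_self hu] at h2
        have h3 := (Complex.continuous_ofReal.tendsto _).comp h2
        rw [Complex.ofReal_one] at h3
        exact h3
      simpa using h1.smul_const (A p.1 * D p.2)
  -- the same integrals, evaluated with the resolvent identity
  have hF1 : ∀ m, Integrable (fun p : ℂ × ℂ =>
      (dbar ψ p.2 * regKernel (δ m) (p.2 - p.1)) • A p.1) (volume.prod volume) := fun m => by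
    have h := (hiψ.smul_prod hφR).swap
    refine (h.norm.const_mul (δ m)⁻¹).mono' ?_ (Eventually.of_forall fun p => ?_)
    · exact (Continuous.aestronglyMeasurable
        ((hcψ.comp continuous_snd).mul (hkc m))).smul hφR.1.comp_fst
    · simp only [Function.comp, Prod.swap, norm_smul, norm_mul]
      have h1 := norm_regKernel_le (hδ m) (p.2 - p.1)
      calc _ = ‖regKernel (δ m) (p.2 - p.1)‖ * (‖dbar ψ p.2‖ * ‖A p.1‖) := by ring
        _ ≤ _ := by gcongr
  have hF2 : ∀ m, Integrable (fun p : ℂ × ℂ =>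
      (dbar φ p.1 * regKernel (δ m) (p.2 - p.1)) • D p.2) (volume.prod volume) := fun m => by
    have h := hiφ.smul_prod hψR
    refine (h.norm.const_mul (δ m)⁻¹).mono' ?_ (Eventually.of_forall fun p => ?_)
    · exact (Continuous.aestronglyMeasurable
        ((hcφ.comp continuous_fst).mul (hkc m))).smul hψR.1.comp_snd
    · simp only [norm_smul, norm_mul]
      have h1 := norm_regKernel_le (hδ m) (p.2 - p.1)
      calc _ = ‖regKernel (δ m) (p.2 - p.1)‖ * (‖dbar φ p.1‖ * ‖D p.2‖) := by ring
        _ ≤ _ := by gcongr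
  have heval : ∀ m, ∫ p : ℂ × ℂ,
      ((p.2 - p.1) * regKernel (δ m) (p.2 - p.1)) • (A p.1 * D p.2) ∂(volume.prod volume) =
      (∫ z, (∫ w, dbar ψ w * regKernel (δ m) (w - z)) • A z) +
        ∫ w, (∫ z, dbar φ z * regKernel (δ m) (z - w)) • D w := fun m => by
    have h1 : ∫ p : ℂ × ℂ,
        ((p.2 - p.1) * regKernel (δ m) (p.2 - p.1)) • (A p.1 * D p.2) ∂(volume.prod volume) =
        ∫ p : ℂ × ℂ, ((dbar ψ p.2 * regKernel (δ m) (p.2 - p.1)) • A p.1 -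
          (dbar φ p.1 * regKernel (δ m) (p.2 - p.1)) • D p.2) ∂(volume.prod volume) := by
      refine integral_congr_ae ?_
      filter_upwards [him] with p hp
      have hr := resolventOp_sub (hH.notMem_opSpectrum (Or.inl hp.1))
        (hH.notMem_opSpectrum (Or.inl hp.2))
      calc _ = (regKernel (δ m) (p.2 - p.1) * dbar φ p.1 * dbar ψ p.2) •
            ((p.2 - p.1) • (resolventOp H p.1 * resolventOp H p.2)) := by
            simp only [hA, hD, smul_mul_assoc, mul_smul_comm, smul_smul]
            congr 1; ring
        _ = _ := by
            rw [← hr]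
            simp only [hA, hD, smul_sub, smul_smul]
            congr 2 <;> ring
    rw [h1, integral_sub (hF1 m) (hF2 m), integral_prod _ (hF1 m), integral_prod_symm _ (hF2 m)]
    simp only [integral_smul_const]
    rw [sub_eq_add_neg, ← integral_neg]
    congr 2
    ext1 w
    rw [← neg_smul, ← integral_neg]
    congr 2
    ext1 z
    rw [← mul_neg, ← regKernel_neg, neg_sub]
  -- both resulting single integrals converge by the approximate Cauchy–Pompeiu formula
  have hlim2 : ∀ {φ₁ ψ₁ : ℂ → ℂ}, ContDiff ℝ ∞ ψ₁ → HasCompactSupport ψ₁ →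
      Integrable (fun z => dbar φ₁ z • resolventOp H z) →
      Integrable (fun z => (-(Real.pi * ψ₁ z)) • (dbar φ₁ z • resolventOp H z)) ∧
      Tendsto (fun m => ∫ z, (∫ w, dbar ψ₁ w * regKernel (δ m) (w - z)) •
        (dbar φ₁ z • resolventOp H z)) atTop
        (𝓝 (∫ z, (-(Real.pi * ψ₁ z)) • (dbar φ₁ z • resolventOp H z))) := by
    intro φ₁ ψ₁ hs hc hi
    obtain ⟨C, hC⟩ := hs.continuous.bounded_above_of_compact_support hc
    constructor
    · have hcont : Continuous fun z => -((Real.pi : ℂ) * ψ₁ z) :=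
        (continuous_const.mul hs.continuous).neg
      refine (hi.norm.const_mul (Real.pi * C)).mono' (hcont.aestronglyMeasurable.smul hi.1)
        (Eventually.of_forall fun z => ?_)
      rw [norm_smul, norm_neg, norm_mul, Complex.norm_real, Real.norm_of_nonneg Real.pi_pos.le]
      have := Real.pi_pos
      gcongr
      exact hC z
    refine tendsto_integral_of_dominated_convergence _ (fun m => ?_) (hi.norm.const_mul (C *
        Real.pi))
      (fun m => Eventually.of_forall fun z => ?_) (Eventually.of_forall fun z => ?_)
    · have hcont : Continuous fun p : ℂ × ℂ => dbar ψ₁ p.2 * regKernel (δ m) (p.2 - p.1) :=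
        ((continuous_dbar (hs.of_le hone)).comp continuous_snd).mul (hkc m)
      have hm : StronglyMeasurable fun z => ∫ w, dbar ψ₁ w * regKernel (δ m) (w - z) :=
        hcont.stronglyMeasurable.integral_prod_right'
      exact hm.aestronglyMeasurable.smul hi.1
    · rw [norm_smul]
      gcongr
      exact norm_integral_dbar_mul_regKernel_le hs hc hC (hδ m) z
    · exact (tendsto_integral_dbar_mul_regKernel hs hc hδ hδ0 z).smul_const _
  obtain ⟨hi1, ht1⟩ := hlim2 hψ hψc hφR
  obtain ⟨hi2, ht2⟩ := hlim2 hφ hφc hψR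
  rw [hprod]
  simp only [heval] at hlim1
  rw [tendsto_nhds_unique hlim1 (ht1.add ht2), ← integral_add hi1 hi2, ← integral_smul]
  congr 1
  ext1 z
  rw [dbar_mul (hφ.differentiable (by simp) z) (hψ.differentiable (by simp) z), smul_smul,
      smul_smul,
    smul_smul, ← add_smul]
  congr 1
  ring

/-- A function that vanishes to order `N + 1` at the real axis does not contribute to the integral:
it may be cut off near the real axis, at a cost that tends to zero. -/
lemma integral_dbar_smul_eq_zero_of_vanishing (hH : SemiboundedHypothesis H α) (hN : α < (N : ℝ))
    {u : ℂ → ℂ} (hu : ContDiff ℝ ∞ u) (hc : HasCompactSupport u)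
    (hsupp : ∀ z, 2 * bracket z.re < |z.im| → u z = 0)
    {C : ℝ} (hC : ∀ z, ‖u z‖ ≤ C * |z.im| ^ (N + 1))
    (hi : Integrable fun z => dbar u z • resolventOp H z) :
    ∫ z, dbar u z • resolventOp H z = 0 := by
  have hone : (1 : WithTop ℕ∞) ≤ ∞ := by exact_mod_cast le_top
  obtain ⟨χ, hχ⟩ := exists_isPlateau
  -- `θ m` vanishes for `|y| ≤ 1 / (m + 1)` and tends to `1` off the real axis
  let M : ℕ → ℝ := fun m => (m : ℝ) + 1
  have hM : ∀ m, 0 < M m := fun m => by positivity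
  have hMlim : Tendsto M atTop atTop := tendsto_atTop_add_const_right _ _
      tendsto_natCast_atTop_atTop
  let θ : ℕ → ℂ → ℂ := fun m z => 1 - χ (M m * z.im)
  have hθ : ∀ m, ContDiff ℝ ∞ (θ m) := fun m =>
    contDiff_const.sub (hχ.smooth.comp (contDiff_const.mul Complex.imCLM.contDiff))
  have hdθ : ∀ m z, dbar (θ m) z = -(2⁻¹ * Complex.I * (M m * deriv χ (M m * z.im))) := fun m z =>
      by
    have h1 : HasDerivAt χ (deriv χ (M m * z.im)) (M m * z.im) :=
      (hχ.smooth.differentiable (by simp)).differentiableAt.hasDerivAt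
    have h2 : HasFDerivAt (fun w : ℂ => M m * w.im) (M m • Complex.imCLM) z :=
      Complex.imCLM.hasFDerivAt.const_mul _
    have h3 : HasFDerivAt (θ m) _ z := (h1.hasFDerivAt.comp z h2).const_sub 1
    rw [dbar, h3.fderiv]
    simp
    ring
  have hzero : ∀ m, ∫ z, dbar (fun w => u w * θ m w) z • resolventOp H z = 0 := fun m => by
    refine integral_dbar_smul_eq_zero (hu.mul (hθ m)) hc.mul_right isOpen_slitSet ?_
      hH.differentiableOn_resolventOp
    have hcl : tsupport (fun w => u w * θ m w) ⊆ {z | 1 ≤ M m * |z.im|} := by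
      refine closure_minimal (fun z hz => ?_) (isClosed_le continuous_const (by fun_prop))
      by_contra h
      refine hz ?_
      have : |M m * z.im| ≤ 1 := by
        rw [abs_mul, abs_of_pos (hM m)]; exact (not_le.1 h).le
      simp only [θ, hχ.eq_one _ this, sub_self, mul_zero]
    refine hcl.trans fun z hz => Or.inl fun h => ?_
    simp only [mem_ofPred_eq, h, abs_zero, mul_zero] at hz
    linarith
  obtain ⟨c, hc0, hcb⟩ := hH.exists_bound_shift
  obtain ⟨C₁, hC₁⟩ := hχ.smooth.continuous.bounded_above_of_compact_support hχ.compact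
  -- `|s χ'(s)|` is bounded, which controls the derivative of the cutoff by `1 / |y|`
  obtain ⟨C₂, hC₂⟩ : ∃ C₂, ∀ s : ℝ, ‖(s : ℂ) * deriv χ s‖ ≤ C₂ :=
    (Complex.continuous_ofReal.mul
      (hχ.smooth.continuous_deriv hone)).bounded_above_of_compact_support hχ.compact.deriv.mul_left
  have hC₂0 : 0 ≤ C₂ := (norm_nonneg _).trans (hC₂ 0)
  have hC0 : 0 ≤ C := by simpa using (norm_nonneg _).trans (hC Complex.I)
  set p : ℝ := (N : ℝ) - 1 - α with hp
  -- powers of the bracket are harmless on the compact support of `u`; they only serve to express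
  -- the bound by `weight`
  obtain ⟨C₃, hC₃0, hC₃⟩ : ∃ C₃, 0 ≤ C₃ ∧ ∀ z ∈ tsupport u,
      ‖bracket z.re ^ (α + 3 + p)‖ ≤ C₃ := by
    obtain ⟨C₃, h⟩ := hc.isCompact.exists_bound_of_continuousOn
      (((continuous_bracket_rpow (α + 3 + p)).comp Complex.continuous_re).continuousOn)
    exact ⟨|C₃|, abs_nonneg _, fun z hz => (h z hz).trans (le_abs_self _)⟩
  have hw := integrable_weight (β := -1) (p := p) (by norm_num) (by rw [hp]; linarith)
  have hlim : Tendsto (fun m => ∫ z, dbar (fun w => u w * θ m w) z • resolventOp H z) atTop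
      (𝓝 (∫ z, dbar u z • resolventOp H z)) := by
    refine tendsto_integral_of_dominated_convergence
      (fun z => (1 + C₁) * ‖dbar u z • resolventOp H z‖ + C * C₂ * c * C₃ * weight (-1) p z)
      (fun m => ?_) ((hi.norm.const_mul _).add (hw.const_mul _)) (fun m => ?_) ?_
    · simpa using aestronglyMeasurable_smul_resolventOp hH
        (continuous_dbar ((hu.mul (hθ m)).of_le hone)) 0
    · filter_upwards [ae_im_ne_zero] with z hz
      have hy : 0 < |z.im| := abs_pos.2 hz
      rw [dbar_mul (hu.differentiable (by simp) z) ((hθ m).differentiable (by simp) z), add_smul]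
      refine (norm_add_le _ _).trans (add_le_add ?_ ?_)
      · rw [mul_comm, mul_smul, norm_smul]
        gcongr
        refine (norm_sub_le _ _).trans ?_
        rw [norm_one]
        gcongr
        exact hC₁ _
      · by_cases hz0 : u z = 0
        · rw [hz0, zero_mul, zero_smul, norm_zero]
          have := weight_nonneg (-1) p z
          positivity
        · have hzb : |z.im| ≤ 2 * bracket z.re := not_lt.1 fun h => hz0 (hsupp z h)
          have hb := bracket_pos z.re
          have h1 : ‖dbar (θ m) z‖ ≤ C₂ * |z.im|⁻¹ := by
            have h := hC₂ (M m * z.im)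
            rw [hdθ, norm_neg]
            rw [← div_eq_mul_inv, le_div_iff₀ hy]
            refine le_trans ?_ h
            simp only [norm_mul, norm_inv, Complex.norm_ofNat, Complex.norm_I, Complex.norm_real,
              Real.norm_eq_abs]
            have : 0 ≤ |M m| * ‖deriv χ (M m * z.im)‖ * |z.im| := by positivity
            nlinarith
          have h2 := hcb z 0 hz hzb (by simp)
          rw [Complex.ofReal_zero, sub_zero] at h2
          have h3 := hC₃ z (subset_tsupport _ hz0)
          rw [Real.norm_of_nonneg (by positivity)] at h3
          rw [norm_smul, norm_mul]
          unfold weight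
          rw [if_pos hzb]
          have e1 : bracket z.re ^ α =
              bracket z.re ^ (α + 3 + p) * bracket z.re ^ (-1 - 2 - p) := by
            rw [← Real.rpow_add hb]; congr 1; ring
          have e2 : |z.im| ^ p = |z.im| ^ (N + 1) * |z.im|⁻¹ * |z.im| ^ (-1 - α) := by
            rw [← Real.rpow_natCast, ← Real.rpow_neg_one, ← Real.rpow_add hy, ← Real.rpow_add hy]
            congr 1; rw [hp]; push_cast; ring
          rw [e1] at h2
          calc _ ≤ (C * |z.im| ^ (N + 1)) * (C₂ * |z.im|⁻¹) *
                (c * (C₃ * bracket z.re ^ (-1 - 2 - p)) * |z.im| ^ (-1 - α)) := by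
                refine mul_le_mul (mul_le_mul (hC z) h1 (norm_nonneg _) (by positivity))
                  (h2.trans ?_) (norm_nonneg _) (by positivity)
                gcongr
            _ = _ := by rw [e2]; ring
    · filter_upwards [ae_im_ne_zero] with z hz
      refine tendsto_const_nhds.congr' ?_
      obtain ⟨R, hR⟩ := hχ.compact.isBounded.subset_closedBall 0
      have hy : 0 < |z.im| := abs_pos.2 hz
      filter_upwards [(hMlim.atTop_mul_const hy).eventually_gt_atTop R] with m hm
      have hout : M m * z.im ∉ tsupport χ := fun h => by
        have := hR h
        rw [mem_closedBall_zero_iff, Real.norm_eq_abs, abs_mul, abs_of_pos (hM m)] at this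
        linarith
      have h0 := notMem_tsupport_iff_eventuallyEq.1 hout
      rw [dbar_mul (hu.differentiable (by simp) z) ((hθ m).differentiable (by simp) z), hdθ,
        h0.deriv_eq]
      simp only [θ, h0.eq_of_nhds]
      simp
  simp only [hzero] at hlim
  exact tendsto_nhds_unique hlim tendsto_const_nhds

end Multiplicativity

section Product

variable {N : ℕ} {τ : ℂ → ℝ}

/-- The polynomial part of the extension is multiplicative up to terms of order at least `N + 1`. -/
lemma taylorPart_mul {f g : ℝ → ℂ} (hf : ContDiff ℝ ∞ f) (hg : ContDiff ℝ ∞ g) (z : ℂ) :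
    taylorPart N f z * taylorPart N g z - taylorPart N (fun x => f x * g x) z =
      ∑ p ∈ (Finset.range (N + 1) ×ˢ Finset.range (N + 1)) with ¬ p.1 + p.2 ≤ N,
        (iteratedDeriv p.1 f z.re / (p.1.factorial : ℂ)) *
          (iteratedDeriv p.2 g z.re / (p.2.factorial : ℂ)) * (Complex.I * (z.im : ℂ)) ^ (p.1 + p.2)
              := by
  set Y := Complex.I * (z.im : ℂ)
  set F : ℕ × ℕ → ℂ := fun p => (iteratedDeriv p.1 f z.re / (p.1.factorial : ℂ)) *
          (iteratedDeriv p.2 g z.re / (p.2.factorial : ℂ)) * Y ^ (p.1 + p.2) with hF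
  have h1 : taylorPart N f z * taylorPart N g z =
      ∑ p ∈ Finset.range (N + 1) ×ˢ Finset.range (N + 1), F p := by
    rw [taylorPart, taylorPart, Finset.sum_mul_sum, Finset.sum_product]
    refine Finset.sum_congr rfl fun i _ => Finset.sum_congr rfl fun j _ => ?_
    simp only [hF, pow_add]
    ring
  have h2 : taylorPart N (fun x => f x * g x) z =
      ∑ p ∈ (Finset.range (N + 1) ×ˢ Finset.range (N + 1)) with p.1 + p.2 ≤ N, F p := by
    rw [← Finset.sum_fiberwise_of_maps_to (s := (Finset.range (N + 1) ×ˢ Finset.range (N +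
        1)).filter
      fun p => p.1 + p.2 ≤ N) (t := Finset.range (N + 1)) (g := fun p => p.1 + p.2)
      (fun p hp => by simp at hp ⊢; omega), taylorPart]
    refine Finset.sum_congr rfl fun r hr => ?_
    have hr' : r ≤ N := by simpa [Nat.lt_succ_iff] using hr
    have hset : ((Finset.range (N + 1) ×ˢ Finset.range (N + 1)).filter
        fun p => p.1 + p.2 ≤ N).filter (fun p => p.1 + p.2 = r) =
            Finset.HasAntidiagonal.antidiagonal r := by
      ext p
      simp only [Finset.mem_filter, Finset.mem_product, Finset.mem_range,
          Finset.HasAntidiagonal.mem_antidiagonal]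
      omega
    rw [hset, Finset.Nat.sum_antidiagonal_eq_sum_range_succ_mk,
      iteratedDeriv_fun_mul (hf.contDiffAt.of_le (by exact_mod_cast le_top))
        (hg.contDiffAt.of_le (by exact_mod_cast le_top)), Finset.sum_mul, Finset.sum_div]
    refine Finset.sum_congr rfl fun i hi => ?_
    have hi' : i ≤ r := by simpa [Nat.lt_succ_iff] using hi
    have n1 : (r.factorial : ℂ) ≠ 0 := by exact_mod_cast r.factorial_ne_zero
    simp only [hF, Y]
    rw [Nat.cast_choose ℂ hi', Nat.add_sub_cancel' hi']
    field_simp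
  rw [h1, h2, ← Finset.sum_filter_add_sum_filter_not _ (fun p : ℕ × ℕ => p.1 + p.2 ≤ N)]
  ring

/-- The difference between the extension of `f g` and the product of the extensions vanishes to
order `N + 1` at the real axis. Near the axis the cutoff is `1`; for `|y| ≥ 1` boundedness is
enough. -/
lemma exists_norm_sub_le_of_hasCompactSupport (hτ : IsCutoff τ) {f g : ℝ → ℂ} (hf : ContDiff ℝ ∞ f)
    (hfc : HasCompactSupport f) (hg : ContDiff ℝ ∞ g) (hgc : HasCompactSupport g) :
    ∃ C, ∀ z, ‖almostAnalyticExt N τ (fun x => f x * g x) z -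
      almostAnalyticExt N τ f z * almostAnalyticExt N τ g z‖ ≤ C * |z.im| ^ (N + 1) := by
  obtain ⟨K₁, hK₁⟩ := exists_symBound (mem_symbolClass_of_hasCompactSupport hf hfc 0) N
  obtain ⟨K₂, hK₂⟩ := exists_symBound (mem_symbolClass_of_hasCompactSupport hg hgc 0) N
  have hbd : ∀ {K : ℝ} {h : ℝ → ℂ}, SymBound N 0 K h → ∀ r ≤ N, ∀ x,
      ‖iteratedDeriv r h x / (r.factorial : ℂ)‖ ≤ K := fun {K h} hK r hr x => by
    rw [norm_div, Complex.norm_natCast]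
    refine (div_le_self (norm_nonneg _) (by exact_mod_cast r.factorial_pos)).trans
      ((hK r hr x).trans (mul_le_of_le_one_right hK.nonneg ?_))
    exact Real.rpow_le_one_of_one_le_of_nonpos (one_le_bracket x) (by simp)
  set u : ℂ → ℂ := fun z => almostAnalyticExt N τ (fun x => f x * g x) z -
      almostAnalyticExt N τ f z * almostAnalyticExt N τ g z with hu
  have hcont : Continuous u := by
    have h1 := (contDiff_almostAnalyticExt (N := N) hτ (hf.mul hg)).continuous
    have h2 := (contDiff_almostAnalyticExt (N := N) hτ hf).continuous
    have h3 := (contDiff_almostAnalyticExt (N := N) hτ hg).continuous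
    exact h1.sub (h2.mul h3)
  have hcs : HasCompactSupport u :=
    (hasCompactSupport_almostAnalyticExt hτ (hfc.mul_right (f' := g))).sub
      (hasCompactSupport_almostAnalyticExt hτ hfc).mul_right
  obtain ⟨C₁, hC₁⟩ := hcont.bounded_above_of_compact_support hcs
  have hC₁0 : 0 ≤ C₁ := (norm_nonneg _).trans (hC₁ 0)
  set S := (Finset.range (N + 1) ×ˢ Finset.range (N + 1)).filter fun p => ¬ p.1 + p.2 ≤ N
  refine ⟨C₁ + ∑ _p ∈ S, K₁ * K₂, fun z => ?_⟩
  change ‖u z‖ ≤ _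
  have hK0 : 0 ≤ ∑ _p ∈ S, K₁ * K₂ := Finset.sum_nonneg fun _ _ => mul_nonneg hK₁.nonneg hK₂.nonneg
  rcases le_total 1 |z.im| with h | h
  · have h1 : 1 ≤ |z.im| ^ (N + 1) := one_le_pow₀ h
    calc _ ≤ C₁ := hC₁ z
      _ ≤ (C₁ + ∑ _p ∈ S, K₁ * K₂) * 1 := by linarith
      _ ≤ _ := by gcongr
  · have hτ1 : τ z = 1 := hτ.eq_one z (h.trans (one_le_bracket _))
    have huz : u z = -(taylorPart N f z * taylorPart N g z - taylorPart N (fun x => f x * g x) z)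
        := by
      simp only [hu, almostAnalyticExt_eq, hτ1]
      push_cast
      ring
    rw [huz, norm_neg, taylorPart_mul hf hg, add_mul, Finset.sum_mul]
    refine (norm_sum_le _ _).trans (le_add_of_nonneg_of_le (by positivity) (Finset.sum_le_sum ?_))
    intro p hp
    simp only [Finset.mem_filter, Finset.mem_product, Finset.mem_range] at hp
    rw [norm_mul, norm_mul, norm_I_mul_im_pow]
    have h1 := hbd hK₁ p.1 (by omega) z.re
    have h2 := hbd hK₂ p.2 (by omega) z.re
    have h3 : |z.im| ^ (p.1 + p.2) ≤ |z.im| ^ (N + 1) :=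
      pow_le_pow_of_le_one (abs_nonneg _) h (by omega)
    have := hK₁.nonneg
    have := hK₂.nonneg
    gcongr

end Product

section Multiplicativity

variable {B : Type*} [NormedAddCommGroup B] [NormedSpace ℂ B] [CompleteSpace B]
  {H : B →ₗ.[ℂ] B} {α : ℝ} {N : ℕ} {τ : ℂ → ℝ}

lemma hsCalculus_mul_of_hasCompactSupport (hH : SemiboundedHypothesis H α) (hN : α < (N : ℝ))
    (hτ : IsCutoff τ) {f g : ℝ → ℂ} (hf : ContDiff ℝ ∞ f) (hfc : HasCompactSupport f)
    (hg : ContDiff ℝ ∞ g) (hgc : HasCompactSupport g) :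
    hsCalculus H N τ (fun x => f x * g x) = hsCalculus H N τ f * hsCalculus H N τ g := by
  have hF := contDiff_almostAnalyticExt (N := N) hτ hf
  have hG := contDiff_almostAnalyticExt (N := N) hτ hg
  have hP := contDiff_almostAnalyticExt (N := N) hτ (hf.mul hg)
  have hFc := hasCompactSupport_almostAnalyticExt (N := N) hτ hfc
  have hGc := hasCompactSupport_almostAnalyticExt (N := N) hτ hgc
  have hPc := hasCompactSupport_almostAnalyticExt (N := N) hτ (hfc.mul_right (f' := g))
  have hiF := integrable_hsIntegrand hH hN hτ (mem_algA_of_hasCompactSupport hf hfc)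
  have hiG := integrable_hsIntegrand hH hN hτ (mem_algA_of_hasCompactSupport hg hgc)
  have hiP := integrable_hsIntegrand hH hN hτ
    (mem_algA_of_hasCompactSupport (hf.mul hg) (hfc.mul_right (f' := g)))
  obtain ⟨C, hC⟩ := exists_norm_sub_le_of_hasCompactSupport (N := N) hτ hf hfc hg hgc
  set F := almostAnalyticExt N τ f
  set G := almostAnalyticExt N τ g
  set P := almostAnalyticExt N τ fun x => f x * g x
  simp only [funext (hsIntegrand_eq (H := H) (N := N) (τ := τ) _)] at hiF hiG hiP
  have hbdd : ∀ {φ : ℂ → ℂ} {A : ℂ → B →L[ℂ] B}, Continuous φ → HasCompactSupport φ → Integrable A →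
      Integrable fun z => φ z • A z := fun {φ A} hφ hφc hA => by
    obtain ⟨K, hK⟩ := hφ.bounded_above_of_compact_support hφc
    refine (hA.norm.const_mul K).mono' (hφ.aestronglyMeasurable.smul hA.1)
      (Eventually.of_forall fun z => ?_)
    rw [norm_smul]
    gcongr
    exact hK z
  have hdFG : ∀ z, dbar (fun w => F w * G w) z • resolventOp H z =
      G z • (dbar F z • resolventOp H z) + F z • (dbar G z • resolventOp H z) := fun z => by
    rw [dbar_mul (hF.differentiable (by simp) z) (hG.differentiable (by simp) z), smul_smul,
      smul_smul, ← add_smul, mul_comm (G z)]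
  have hiFG : Integrable fun z => dbar (fun w => F w * G w) z • resolventOp H z := by
    have h1 := hbdd hG.continuous hGc hiF
    have h2 := hbdd hF.continuous hFc hiG
    simp only [hdFG]
    exact Integrable.fun_add (ε' := B →L[ℂ] B) h1 h2
  have hdu : ∀ z, dbar (fun w => P w - F w * G w) z • resolventOp H z =
      dbar P z • resolventOp H z - dbar (fun w => F w * G w) z • resolventOp H z := fun z => by
    rw [dbar_sub (hP.differentiable (by simp) z) ((hF.mul hG).differentiable (by simp) z), sub_smul]
  have hzero := integral_dbar_smul_eq_zero_of_vanishing hH hN (u := fun w => P w - F w * G w)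
    (hP.sub (hF.mul hG)) (hPc.sub hFc.mul_right)
    (fun z hz => by
      have h1 : P z = 0 := (almostAnalyticExt_eventuallyEq_zero hτ N _ hz).eq_of_nhds
      have h2 : F z = 0 := (almostAnalyticExt_eventuallyEq_zero hτ N _ hz).eq_of_nhds
      simp only [h1, h2, zero_mul, sub_zero]) hC
    (by simp only [hdu]; exact hiP.sub hiFG)
  simp only [hdu] at hzero
  rw [integral_sub hiP hiFG, sub_eq_zero] at hzero
  have hmul := integral_dbar_smul_mul_integral_dbar_smul hH hF hFc hG hGc hiF hiG
  simp only [hsCalculus, funext (hsIntegrand_eq (H := H) (N := N) (τ := τ) _)]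
  change _ • ∫ z, dbar P z • resolventOp H z = (_ • ∫ z, dbar F z • resolventOp H z) *
    (_ • ∫ z, dbar G z • resolventOp H z)
  rw [smul_mul_assoc, mul_smul_comm, hmul, hzero, smul_smul, smul_smul]
  congr 1
  have : (Real.pi : ℂ) ≠ 0 := by exact_mod_cast Real.pi_ne_zero
  field_simp

/-- Multiplicativity on `𝒜`. The product of the truncations by `χ` is the truncation of `f g`
by `χ²`, which is again a plateau function. -/
theorem hsCalculus_mul (hH : SemiboundedHypothesis H α) (hN : α < (N : ℝ))
    (hτ : IsCutoff τ) {f g : ℝ → ℂ} (hf : f ∈ algA) (hg : g ∈ algA) :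
    hsCalculus H N τ (fun x => f x * g x) = hsCalculus H N τ f * hsCalculus H N τ g := by
  obtain ⟨χ, hχ⟩ := exists_isPlateau
  have h1 := (tendsto_hsCalculus_truncate hH hN hτ hχ hf).mul
    (tendsto_hsCalculus_truncate hH hN hτ hχ hg)
  have h2 := tendsto_hsCalculus_truncate hH hN hτ (hχ.mul hχ) (algA.mul hf hg)
  refine tendsto_nhds_unique h2 (h1.congr fun m => ?_)
  rw [← hsCalculus_mul_of_hasCompactSupport hH hN hτ (contDiff_truncate hχ (algA.contDiff hf) m)
    (hasCompactSupport_truncate hχ m) (contDiff_truncate hχ (algA.contDiff hg) m)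
    (hasCompactSupport_truncate hχ m)]
  congr 1
  ext x
  simp only [truncate]
  ring

end Multiplicativity

/-! ### The functions `e^{-sⁿt}` -/

section Exp

open Polynomial

lemma contDiff_expFun (n : ℕ) (t : ℝ) : ContDiff ℝ ∞ (expFun n t) := by
  have h : ContDiff ℝ ∞ fun s : ℝ => (s : ℂ) := Complex.ofRealCLM.contDiff
  exact ((h.pow n).mul contDiff_const).neg.cexp

lemma expFun_add (n : ℕ) (t₁ t₂ s : ℝ) :
    expFun n (t₁ + t₂) s = expFun n t₁ s * expFun n t₂ s := by
  rw [expFun, expFun, expFun, ← Complex.exp_add]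
  push_cast
  congr 1; ring

/-- The derivatives of `e^{-sⁿt}` are polynomial multiples of it. -/
lemma exists_iteratedDeriv_expFun_eq (n : ℕ) (t : ℝ) (k : ℕ) :
    ∃ p : ℂ[X], ∀ s : ℝ, iteratedDeriv k (expFun n t) s = p.eval (s : ℂ) * expFun n t s := by
  induction k with
  | zero => exact ⟨1, fun s => by simp⟩
  | succ k ih =>
    obtain ⟨p, hp⟩ := ih
    let q : ℂ[X] := -(X ^ n * C (t : ℂ))
    refine ⟨derivative p + p * derivative q, fun s => ?_⟩
    have h1 : ∀ s : ℝ, expFun n t s = Complex.exp (q.eval (s : ℂ)) := fun s => by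
      simp only [expFun, q, eval_neg, eval_mul, eval_pow, eval_X, eval_C]
    have hd : HasDerivAt (fun z : ℂ => p.eval z * Complex.exp (q.eval z))
        ((derivative p).eval (s : ℂ) * Complex.exp (q.eval (s : ℂ)) +
          p.eval (s : ℂ) * (Complex.exp (q.eval (s : ℂ)) * (derivative q).eval (s : ℂ))) (s : ℂ) :=
      (p.hasDerivAt _).mul (q.hasDerivAt _).cexp
    rw [iteratedDeriv_succ, funext hp]
    simp only [h1]
    rw [hd.comp_ofReal.deriv, eval_add, eval_mul]
    ring

/-- Polynomial growth is bounded by a power of `1 + s` on the half-line. -/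
lemma exists_norm_eval_le (p : ℂ[X]) :
    ∃ C : ℝ, 0 ≤ C ∧ ∃ d : ℕ, ∀ s : ℝ, 0 ≤ s → ‖p.eval (s : ℂ)‖ ≤ C * (1 + s) ^ d := by
  refine ⟨∑ i ∈ Finset.range (p.natDegree + 1), ‖p.coeff i‖, by positivity, p.natDegree,
    fun s hs => ?_⟩
  rw [eval_eq_sum_range, Finset.sum_mul]
  refine (norm_sum_le _ _).trans (Finset.sum_le_sum fun i hi => ?_)
  rw [norm_mul, norm_pow, Complex.norm_real, Real.norm_of_nonneg hs]
  have hi' : i ≤ p.natDegree := by simpa [Nat.lt_succ_iff] using hi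
  gcongr
  calc s ^ i ≤ (1 + s) ^ i := by gcongr; linarith
    _ ≤ _ := pow_le_pow_right₀ (by linarith) hi'

/-- For `s ≥ 0` one has `sⁿ ≥ s - 1`, so `e^{-sⁿt}` decays at least like `e^{-ts}`. -/
lemma norm_expFun_mul_pow_le {n : ℕ} (hn : 1 ≤ n) {t : ℝ} (ht : 0 < t) (D : ℕ) {s : ℝ} (hs : 0 ≤ s)
    :
    ‖expFun n t s‖ * (1 + s) ^ D ≤ Real.exp (2 * t) * (D.factorial / t ^ D) := by
  have h1 : ‖expFun n t s‖ = Real.exp (-(s ^ n * t)) := by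
    rw [expFun, Complex.norm_exp]
    congr 1
    rw [← Complex.ofReal_pow, ← Complex.ofReal_mul, ← Complex.ofReal_neg, Complex.ofReal_re]
  have h2 : s - 1 ≤ s ^ n := by
    rcases le_total s 1 with h | h
    · have := pow_nonneg hs n; linarith
    · have := le_self_pow₀ h (by omega : n ≠ 0); linarith
  have h3 := Real.pow_div_factorial_le_exp (t * (1 + s)) (by positivity) D
  have h4 : (1 + s) ^ D ≤ Real.exp (t * (1 + s)) * (D.factorial / t ^ D) := by
    rw [mul_pow, div_le_iff₀ (by positivity)] at h3
    rw [mul_div_assoc', le_div_iff₀ (by positivity)]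
    linarith
  rw [h1]
  calc _ ≤ Real.exp (-(s ^ n * t)) * (Real.exp (t * (1 + s)) * (D.factorial / t ^ D)) := by gcongr
    _ = Real.exp (-(s ^ n * t) + t * (1 + s)) * (D.factorial / t ^ D) := by
        rw [Real.exp_add]; ring
    _ ≤ _ := by
        gcongr
        nlinarith

lemma exists_norm_iteratedDeriv_expFun_le {n : ℕ} (hn : 1 ≤ n) {t : ℝ} (ht : 0 < t) (k : ℕ) :
    ∃ c : ℝ, 0 < c ∧ ∀ s : ℝ, 0 ≤ s →
      ‖iteratedDeriv k (expFun n t) s‖ ≤ c * bracket s ^ ((-1 : ℝ) - (k : ℝ)) := by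
  obtain ⟨p, hp⟩ := exists_iteratedDeriv_expFun_eq n t k
  obtain ⟨C, hC0, d, hd⟩ := exists_norm_eval_le p
  set L := Real.exp (2 * t) * ((d + (k + 1)).factorial / t ^ (d + (k + 1)))
  have hL : 0 ≤ L := by positivity
  refine ⟨C * L + 1, by positivity, fun s hs => ?_⟩
  have hb := bracket_pos s
  have h1 := norm_expFun_mul_pow_le hn ht (d + (k + 1)) hs
  have h2 : bracket s ≤ 1 + s := by
    have := bracket_le_one_add_norm s
    rwa [Real.norm_of_nonneg hs] at this
  have e : bracket s ^ ((-1 : ℝ) - (k : ℝ)) = (bracket s ^ (k + 1))⁻¹ := by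
    rw [← Real.rpow_natCast, ← Real.rpow_neg hb.le]; congr 1; push_cast; ring
  rw [hp, norm_mul, e, ← div_eq_mul_inv, le_div_iff₀ (by positivity)]
  calc _ ≤ C * (1 + s) ^ d * ‖expFun n t s‖ * (1 + s) ^ (k + 1) := by
        gcongr; exact hd s hs
    _ = C * (‖expFun n t s‖ * (1 + s) ^ (d + (k + 1))) := by rw [pow_add _ d]; ring
    _ ≤ C * L := by gcongr
    _ ≤ _ := by linarith

lemma expFun_mem_algAPlus {n : ℕ} (hn : 1 ≤ n) {t : ℝ} (ht : 0 < t) : expFun n t ∈ algAPlus := by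
  refine ⟨-1, by norm_num, (contDiff_expFun n t).contDiffOn, fun k => ?_⟩
  obtain ⟨c, hc, h⟩ := exists_norm_iteratedDeriv_expFun_le hn ht k
  refine ⟨c, hc, fun x hx => ?_⟩
  rw [iteratedDerivWithin_eq_iteratedDeriv (uniqueDiffOn_Ici 0)
    ((contDiff_expFun n t).contDiffAt.of_le (by exact_mod_cast le_top)) hx]
  exact h x hx

/-- Multiplication by a smooth step that is `1` for `s ≥ -1/2` and `0` for `s ≤ -1` extends
`e^{-sⁿt}` from `[0, ∞)` to an element of `𝒜`. -/
lemma exists_isExtension_expFun {n : ℕ} (hn : 1 ≤ n) {t : ℝ} (ht : 0 < t) :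
    ∃ g, IsExtension g (expFun n t) := by
  let g : ℝ → ℂ := fun s => expFun n t s * (Real.smoothTransition (2 * s + 2) : ℂ)
  have hg : ContDiff ℝ ∞ g := (contDiff_expFun n t).mul (Complex.ofRealCLM.contDiff.comp
    (Real.smoothTransition.contDiff.comp ((contDiff_const.mul contDiff_id).add contDiff_const)))
  have hone : ∀ s, -(1 / 2) ≤ s → g s = expFun n t s := fun s hs => by
    simp only [g]
    rw [Real.smoothTransition.one_of_one_le (by linarith), Complex.ofReal_one, mul_one]
  have hzero : ∀ s, s ≤ -1 → g s = 0 := fun s hs => by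
    simp only [g]
    rw [Real.smoothTransition.zero_of_nonpos (by linarith), Complex.ofReal_zero, mul_zero]
  refine ⟨g, ⟨-1, by norm_num, hg, fun k => ?_⟩, fun s hs => hone s ?_⟩
  -- the estimate on `[0, ∞)` is that of `e^{-sⁿt}`, on `[-1, 0]` it follows from compactness, and
  -- `g` vanishes to the left of `-1`
  · obtain ⟨c, hc, h⟩ := exists_norm_iteratedDeriv_expFun_le hn ht k
    obtain ⟨C, hC⟩ := (isCompact_Icc (a := (-1 : ℝ)) (b := 0)).exists_bound_of_continuousOn
      ((Complex.continuous_ofReal.comp (continuous_bracket_rpow (-((-1 : ℝ) - (k : ℝ))))).mul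
        (hg.continuous_iteratedDeriv k (by exact_mod_cast le_top))).continuousOn
    refine ⟨c + |C|, by positivity, fun x => ?_⟩
    have hp : 0 < bracket x ^ ((-1 : ℝ) - (k : ℝ)) := Real.rpow_pos_of_pos (bracket_pos x) _
    rcases le_or_gt 0 x with hx | hx
    · have hev : g =ᶠ[𝓝 x] expFun n t := by
        filter_upwards [Ioi_mem_nhds (by linarith : -(1 / 2 : ℝ) < x)] with y hy
        exact hone y (le_of_lt hy)
      rw [hev.iteratedDeriv_eq]
      refine (h x hx).trans ?_
      gcongr
      linarith [abs_nonneg C]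
    rcases le_or_gt (-1) x with hx1 | hx1
    · have h1 := hC x ⟨hx1, hx.le⟩
      rw [Pi.mul_apply, Function.comp_apply, norm_mul, Complex.norm_real,
        Real.rpow_neg (bracket_pos x).le, norm_inv, Real.norm_of_nonneg hp.le,
        inv_mul_le_iff₀ hp] at h1
      nlinarith [le_abs_self C]
    · have hev : g =ᶠ[𝓝 x] fun _ => 0 := by
        filter_upwards [Iio_mem_nhds hx1] with y hy using hzero y (le_of_lt hy)
      rw [hev.iteratedDeriv_eq, iteratedDeriv_fun_const_zero, norm_zero]
      positivity
  · have : (0 : ℝ) ≤ s := hs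
    linarith

end Exp

/-! ### The semigroup law -/

section Semigroup

variable {B : Type*} [NormedAddCommGroup B] [NormedSpace ℂ B] [CompleteSpace B]
  {H : B →ₗ.[ℂ] B} {α : ℝ} {N : ℕ} {τ : ℂ → ℝ}

lemma gammaCalculus_eq (hH : SemiboundedHypothesis H α) (hN : α < (N : ℝ))
    (hτ : IsCutoff τ) {f g : ℝ → ℂ} (hg : IsExtension g f) :
    gammaCalculus H N τ f = hsCalculus H N τ g := by
  have h : ∃ g, IsExtension g f := ⟨g, hg⟩
  rw [gammaCalculus, dif_pos h]
  exact hsCalculus_eq_of_eqOn hH hN hτ h.choose_spec.1 hg.1 (h.choose_spec.2.trans hg.2.symm)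

lemma expPow_add (hH : SemiboundedHypothesis H α) (hN : α < (N : ℝ))
    (hτ : IsCutoff τ) {n : ℕ} (hn : 1 ≤ n) {t₁ t₂ : ℝ} (h₁ : 0 < t₁) (h₂ : 0 < t₂) :
    expPow H N τ n (t₁ + t₂) = expPow H N τ n t₁ * expPow H N τ n t₂ := by
  obtain ⟨g₁, hg₁⟩ := exists_isExtension_expFun hn h₁
  obtain ⟨g₂, hg₂⟩ := exists_isExtension_expFun hn h₂
  have hg : IsExtension (fun s => g₁ s * g₂ s) (expFun n (t₁ + t₂)) :=
    ⟨algA.mul hg₁.1 hg₂.1, fun s hs => by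
      simp only [hg₁.2 hs, hg₂.2 hs, expFun_add]⟩
  rw [expPow, expPow, expPow, gammaCalculus_eq hH hN hτ hg, gammaCalculus_eq hH hN hτ hg₁,
    gammaCalculus_eq hH hN hτ hg₂, hsCalculus_mul hH hN hτ hg₁.1 hg₂.1]

end Semigroup

end HelfferSjostrand

/-- The first conjunct says that `e^{-Hⁿt}` is well defined: `e^{-sⁿt}` lies in `𝒜⁺` and extends to
an element of `𝒜`, and for every such extension `g` the integral for `g(H)` converges in norm and
equals `e^{-Hⁿt}`. The second conjunct is the semigroup law. -/
theorem mainTheorem9 {B : Type*} [NormedAddCommGroup B] [NormedSpace ℂ B] [CompleteSpace B]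
    (H : B →ₗ.[ℂ] B) (α : ℝ) (hH : HelfferSjostrand.SemiboundedHypothesis H α)
    (N : ℕ) (hN : α < (N : ℝ)) (τ : ℂ → ℝ) (hτ : HelfferSjostrand.IsCutoff τ)
    (n : ℕ) (hn : 1 ≤ n) :
    (∀ t : ℝ, 0 < t →
      HelfferSjostrand.expFun n t ∈ HelfferSjostrand.algAPlus ∧
      (∃ g : ℝ → ℂ, HelfferSjostrand.IsExtension g (HelfferSjostrand.expFun n t)) ∧
      ∀ g : ℝ → ℂ, HelfferSjostrand.IsExtension g (HelfferSjostrand.expFun n t) →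
        MeasureTheory.Integrable (HelfferSjostrand.hsIntegrand H N τ g) ∧
        HelfferSjostrand.expPow H N τ n t = HelfferSjostrand.hsCalculus H N τ g) ∧
    ∀ t₁ t₂ : ℝ, 0 < t₁ → 0 < t₂ →
      HelfferSjostrand.expPow H N τ n (t₁ + t₂) =
        HelfferSjostrand.expPow H N τ n t₁ * HelfferSjostrand.expPow H N τ n t₂ := by
  exact ⟨fun t ht => ⟨HelfferSjostrand.expFun_mem_algAPlus hn ht,
    HelfferSjostrand.exists_isExtension_expFun hn ht, fun g hg =>
      ⟨HelfferSjostrand.integrable_hsIntegrand hH hN hτ hg.1,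
        HelfferSjostrand.gammaCalculus_eq hH hN hτ hg⟩⟩,
    fun t₁ t₂ h₁ h₂ => HelfferSjostrand.expPow_add hH hN hτ hn h₁ h₂⟩
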